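/- Let $\mathcal C$ be a semisimple braided tensor category, that is, an abelian braided monoidal category with biadditive tensor product $\boxtimes$ and braiding $\mathcal R$ in which every object is a finite direct sum of simple objects. Let $\mathcal C^{\oplus}$ be its direct sum completion: its objects are formal direct sums $\bigoplus_{s\in S}X_s$ of objects of $\mathcal C$ over arbitrary index sets $S$, a morphism $\bigoplus_{s\in S}X_s\to\bigoplus_{t\in T}Y_t$ is a matrix of morphisms $X_s\to Y_t$ such that for each $s$ only finitely many entries are non-zero, and the braided tensor structure is defined componentwise. Let $(A,\mu,\iota)$ be a unital associative algebra object in $\mathcal C^{\oplus}$ with a decomposition $A=A^{0}\oplus A^{1}$ such that $\iota$ and $\mu$ are even and $A$ is supercommutative, i.e. $\mu\circ\mathcal R_{A,A}=(-1)^{ab}\mu$ on $A^a\boxtimes A^b$. Suppose that $A$ is a simple current extension: $A$ is simple as a module over itself, and $A\cong\bigoplus_{i\in I}J_i$, where the $J_i$ are pairwise non-isomorphic simple currents (invertible objects) of $\mathcal C$. Suppose also that $A$ is fixed-point free: there are no simple object $M$ of $\mathcal C$ and $i, j\in I$ with $J_i\not\cong J_j$ and $J_i\boxtimes M\cong J_j\boxtimes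 M$. Consider the category of local $A$-modules in $\mathcal C^{\oplus}$, i.e. the full subcategory of the category of left $A$-modules in $\mathcal C^{\oplus}$ consisting of those $(X,\mu_X)$ with $\mu_X\circ\mathcal R_{X,A}\circ\mathcal R_{A,X}=\mu_X$. Then: 1. this category is semisimple, i.e. each of its objects is a (possibly infinite) direct sum of simple objects; 2. every object of it is isomorphic, as an $A$-module, to an induced module $\mathcal F_A(W)=A\boxtimes W$ (with $A$ acting by multiplication on the first factor) for some object $W$ of $\mathcal C^{\oplus}$. -/

import Mathlib

open CategoryTheory MonoidalCategory Limits

universe w v u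

noncomputable section

/-! ## The direct sum completion of a preadditive category -/

/-- An object of the direct sum completion `C^⊕` of `C`: a formal direct sum `⨁_{s ∈ ι} obj s` of a
family of objects of `C` indexed by an arbitrary set `ι`. -/
structure DirectSumCompletion (C : Type u) where
  /-- The index set. -/
  ι : Type w
  /-- The summands. -/
  obj : ι → C

namespace DirectSumCompletion

section Preadditive

variable {C : Type u} [Category.{v} C] [Preadditive C]

/-- The morphisms from an object `X` of `C` to a formal direct sum `Y`: families of morphisms
`X ⟶ Y.obj t` of which only finitely many are nonzero. -/
abbrev Col (X : C) (Y : DirectSumCompletion.{w} C) : Type (max w v) :=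
  DirectSum Y.ι (fun t => X ⟶ Y.obj t)

/-- The morphism into a formal direct sum with a single component. -/
def single {X : C} {Y : DirectSumCompletion.{w} C} (t : Y.ι) : (X ⟶ Y.obj t) →+ Col X Y :=
  letI := Classical.decEq Y.ι
  DirectSum.of (fun t => X ⟶ Y.obj t) t

/-- Extend additive maps on the components additively to `Col X Y`. -/
def lift {X : C} {Y : DirectSumCompletion.{w} C} {G : Type*} [AddCommMonoid G]
    (φ : ∀ t, (X ⟶ Y.obj t) →+ G) : Col X Y →+ G :=
  letI := Classical.decEq Y.ι
  DirectSum.toAddMonoid φ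

@[simp]
lemma lift_single {X : C} {Y : DirectSumCompletion.{w} C} {G : Type*} [AddCommMonoid G]
    (φ : ∀ t, (X ⟶ Y.obj t) →+ G) (t : Y.ι) (f : X ⟶ Y.obj t) :
    lift φ (single t f) = φ t f := by
  let := Classical.decEq Y.ι
  exact DirectSum.toAddMonoid_of φ t f

lemma col_induction {X : C} {Y : DirectSumCompletion.{w} C} {p : Col X Y → Prop} (x : Col X Y)
    (zero : p 0) (of : ∀ t f, p (single t f)) (add : ∀ a b, p a → p b → p (a + b)) : p x := by
  let := Classical.decEq Y.ι
  exact DirectSum.induction_on x zero of add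

/-- Precomposition with a morphism of `C`, as a biadditive map. -/
def pre {X X' : C} {Y : DirectSumCompletion.{w} C} : (X ⟶ X') →+ Col X' Y →+ Col X Y where
  toFun φ := DirectSum.map (fun t => Preadditive.leftComp (Y.obj t) φ)
  map_zero' := by
    ext x t
    exact zero_comp
  map_add' φ ψ := by
    ext x t
    exact Preadditive.add_comp _ _ _ φ ψ (x t)

@[simp]
lemma pre_single {X X' : C} {Y : DirectSumCompletion.{w} C} (φ : X ⟶ X') (t : Y.ι)
    (f : X' ⟶ Y.obj t) : pre φ (single t f) = single t (φ ≫ f) := by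
  let := Classical.decEq Y.ι
  exact DirectSum.map_of (fun t => Preadditive.leftComp (Y.obj t) φ) t f

@[simp]
lemma pre_id {X : C} {Y : DirectSumCompletion.{w} C} (x : Col X Y) : pre (𝟙 X) x = x := by
  induction x using col_induction with
  | zero => simp
  | of t f => simp
  | add a b ha hb => simp [ha, hb]

lemma pre_pre {X X' X'' : C} {Y : DirectSumCompletion.{w} C} (φ : X ⟶ X') (ψ : X' ⟶ X'')
    (x : Col X'' Y) : pre φ (pre ψ x) = pre (φ ≫ ψ) x := by
  induction x using col_induction with
  | zero => simp
  | of t f => simp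
  | add a b ha hb => simp [ha, hb]

/-- A morphism `⨁_s X_s ⟶ ⨁_t Y_t` of formal direct sums: a matrix of morphisms `X_s ⟶ Y_t` such
that for each `s` only finitely many entries are nonzero. -/
@[ext]
structure Hom (X Y : DirectSumCompletion.{w} C) where
  /-- The restriction of the morphism to the summand `X.obj s`. -/
  col : ∀ s, Col (X.obj s) Y

/-- Composition of a morphism out of an object of `C` with a morphism of formal direct sums:
the `u`-th component is `∑ t, x_t ≫ g_{t,u}`. -/
def post {X : C} {Y Z : DirectSumCompletion.{w} C} (g : Hom Y Z) : Col X Y →+ Col X Z :=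
  lift (fun t => pre.flip (g.col t))

@[simp]
lemma post_single {X : C} {Y Z : DirectSumCompletion.{w} C} (g : Hom Y Z) (t : Y.ι)
    (f : X ⟶ Y.obj t) : post g (single t f) = pre f (g.col t) := by
  simp [post]

lemma post_pre {X X' : C} {Y Z : DirectSumCompletion.{w} C} (g : Hom Y Z) (φ : X ⟶ X')
    (x : Col X' Y) : post g (pre φ x) = pre φ (post g x) := by
  induction x using col_induction with
  | zero => simp
  | of t f => simp [pre_pre]
  | add a b ha hb => simp [ha, hb]

/-- Matrices compose by matrix multiplication. -/
instance : Category.{max w v} (DirectSumCompletion.{w} C) where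
  Hom := Hom
  id X := ⟨fun s => single s (𝟙 (X.obj s))⟩
  comp f g := ⟨fun s => post g (f.col s)⟩
  id_comp f := by
    ext s : 2
    simp
  comp_id {X Y} f := by
    apply Hom.ext
    funext s
    change post _ (f.col s) = f.col s
    generalize f.col s = x
    induction x using col_induction with
    | zero => simp
    | of t f => simp
    | add a b ha hb => simp only [map_add, ha, hb]
  assoc f g h := by
    apply Hom.ext
    funext s
    change post h (post g (f.col s)) = post _ (f.col s)
    generalize f.col s = x
    induction x using col_induction with
    | zero => simp
    | of t f => simp [post_pre]
    | add a b ha hb => simp only [map_add, ha, hb]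

@[ext]
lemma hom_ext {X Y : DirectSumCompletion.{w} C} {f g : X ⟶ Y}
    (h : ∀ s, Hom.col f s = Hom.col g s) : f = g :=
  Hom.ext (funext h)

@[simp]
lemma id_col (X : DirectSumCompletion.{w} C) (s : X.ι) :
    Hom.col (𝟙 X) s = single s (𝟙 (X.obj s)) := rfl

@[simp]
lemma comp_col {X Y Z : DirectSumCompletion.{w} C} (f : X ⟶ Y) (g : Y ⟶ Z) (s : X.ι) :
    Hom.col (f ≫ g) s = post g (Hom.col f s) := rfl

/-- The bijection between morphisms and families of columns. -/
def colEquiv (X Y : DirectSumCompletion.{w} C) : (X ⟶ Y) ≃ (∀ s, Col (X.obj s) Y) where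
  toFun f := Hom.col f
  invFun f := ⟨f⟩
  left_inv _ := rfl
  right_inv _ := rfl

/-- Matrices are added entrywise. -/
instance (X Y : DirectSumCompletion.{w} C) : AddCommGroup (X ⟶ Y) := (colEquiv X Y).addCommGroup

@[simp]
lemma zero_col {X Y : DirectSumCompletion.{w} C} (s : X.ι) : Hom.col (0 : X ⟶ Y) s = 0 := rfl

@[simp]
lemma add_col {X Y : DirectSumCompletion.{w} C} (f g : X ⟶ Y) (s : X.ι) :
    Hom.col (f + g) s = Hom.col f s + Hom.col g s := rfl

lemma post_add {X : C} {Y Z : DirectSumCompletion.{w} C} (g h : Y ⟶ Z) (x : Col X Y) :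
    post (g + h) x = post g x + post h x := by
  induction x using col_induction with
  | zero => simp
  | of t f => simp
  | add a b ha hb =>
    simp only [map_add, ha, hb]
    abel

instance : Preadditive (DirectSumCompletion.{w} C) where
  add_comp P Q R f f' g := by
    ext s : 1
    simp
  comp_add P Q R f g g' := by
    ext s : 1
    simp [post_add]

/-- The morphism with exactly one prescribed entry in each column. -/
def monomial {X Y : DirectSumCompletion.{w} C} (e : X.ι → Y.ι)
    (φ : ∀ s, X.obj s ⟶ Y.obj (e s)) : X ⟶ Y :=
  Hom.mk (fun s => single (e s) (φ s))

@[simp]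
lemma monomial_col {X Y : DirectSumCompletion.{w} C} (e : X.ι → Y.ι)
    (φ : ∀ s, X.obj s ⟶ Y.obj (e s)) (s : X.ι) :
    Hom.col (monomial e φ) s = single (e s) (φ s) := rfl

lemma monomial_congr {X Y : DirectSumCompletion.{w} C} {e : X.ι → Y.ι}
    {φ ψ : ∀ s, X.obj s ⟶ Y.obj (e s)} (h : ∀ s, φ s = ψ s) : monomial e φ = monomial e ψ := by
  rw [funext h]

lemma id_eq_monomial (X : DirectSumCompletion.{w} C) :
    𝟙 X = monomial (fun s => s) (fun s => 𝟙 (X.obj s)) := rfl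

lemma monomial_comp {X Y Z : DirectSumCompletion.{w} C} (e : X.ι → Y.ι)
    (φ : ∀ s, X.obj s ⟶ Y.obj (e s)) (e' : Y.ι → Z.ι) (ψ : ∀ t, Y.obj t ⟶ Z.obj (e' t)) :
    monomial e φ ≫ monomial e' ψ = monomial (fun s => e' (e s)) (fun s => φ s ≫ ψ (e s)) := by
  ext s : 1
  simp

lemma eq_comp {X Y Z : DirectSumCompletion.{w} C} {f : X ⟶ Y} {g : Y ⟶ Z} {e : X.ι → Y.ι}
    {φ : ∀ s, X.obj s ⟶ Y.obj (e s)} {e' : Y.ι → Z.ι} {ψ : ∀ t, Y.obj t ⟶ Z.obj (e' t)}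
    (hf : f = monomial e φ) (hg : g = monomial e' ψ) :
    f ≫ g = monomial (fun s => e' (e s)) (fun s => φ s ≫ ψ (e s)) := by
  rw [hf, hg, monomial_comp]

lemma eq_of_eq_monomial {X Y : DirectSumCompletion.{w} C} {f g : X ⟶ Y} {e : X.ι → Y.ι}
    {φ ψ : ∀ s, X.obj s ⟶ Y.obj (e s)} (hf : f = monomial e φ) (hg : g = monomial e ψ)
    (h : ∀ s, φ s = ψ s) : f = g := by
  rw [hf, hg, monomial_congr h]

/-- A bijective reindexing together with isomorphisms of the summands is an isomorphism. -/
def monomialIso {X Y : DirectSumCompletion.{w} C} (e : X.ι → Y.ι)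
    (φ : ∀ s, X.obj s ⟶ Y.obj (e s)) (e' : Y.ι → X.ι) (ψ : ∀ t, Y.obj t ⟶ X.obj (e' t))
    (h : monomial (fun s => e' (e s)) (fun s => φ s ≫ ψ (e s)) = 𝟙 X)
    (h' : monomial (fun t => e (e' t)) (fun t => ψ t ≫ φ (e' t)) = 𝟙 Y) : X ≅ Y where
  hom := monomial e φ
  inv := monomial e' ψ
  hom_inv_id := (monomial_comp ..).trans h
  inv_hom_id := (monomial_comp ..).trans h'

end Preadditive

/-! ## The braided monoidal structure on the direct sum completion -/

section Monoidal

variable {C : Type u} [Category.{v} C] [Preadditive C] [MonoidalCategory C] [MonoidalPreadditive C]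

/-- The tensor product `(⨁_s X_s) ⊗ (⨁_t Y_t) = ⨁_{(s,t)} X_s ⊗ Y_t`. -/
abbrev tensor (X Y : DirectSumCompletion.{w} C) : DirectSumCompletion.{w} C where
  ι := X.ι × Y.ι
  obj p := X.obj p.1 ⊗ Y.obj p.2

/-- The tensor product of morphisms of `C`, as a biadditive map. -/
def tensorAddHom {X X' Y Y' : C} : (X ⟶ Y) →+ (X' ⟶ Y') →+ (X ⊗ X' ⟶ Y ⊗ Y') where
  toFun f :=
    { toFun := fun g => f ⊗ₘ g
      map_zero' := MonoidalPreadditive.tensor_zero f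
      map_add' := MonoidalPreadditive.tensor_add f }
  map_zero' := by
    ext g
    exact MonoidalPreadditive.zero_tensor g
  map_add' f f' := by
    ext g
    exact MonoidalPreadditive.add_tensor f f' g

@[simp]
lemma tensorAddHom_apply {X X' Y Y' : C} (f : X ⟶ Y) (g : X' ⟶ Y') :
    tensorAddHom f g = f ⊗ₘ g := rfl

/-- The tensor product of columns: the `(t, t')`-component is `x_t ⊗ y_{t'}`. -/
def tensorCol {X X' : C} {Y Y' : DirectSumCompletion.{w} C} :
    Col X Y →+ Col X' Y' →+ Col (X ⊗ X') (tensor Y Y') :=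
  lift (fun t => AddMonoidHom.flip (lift (fun t' => AddMonoidHom.flip
    ((AddMonoidHom.compHom (single (Y := tensor Y Y') (t, t'))).comp tensorAddHom))))

@[simp]
lemma tensorCol_single {X X' : C} {Y Y' : DirectSumCompletion.{w} C} (t : Y.ι) (t' : Y'.ι)
    (f : X ⟶ Y.obj t) (g : X' ⟶ Y'.obj t') :
    tensorCol (single t f) (single t' g) = single (Y := tensor Y Y') (t, t') (f ⊗ₘ g) := by
  simp only [tensorCol, lift_single, AddMonoidHom.flip_apply]
  rfl

/-- The tensor product of morphisms, given entrywise by the tensor product of `C`. -/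
def tensorMap {X Y X' Y' : DirectSumCompletion.{w} C} (f : X ⟶ Y) (g : X' ⟶ Y') :
    tensor X X' ⟶ tensor Y Y' :=
  Hom.mk (X := tensor X X') (fun p => tensorCol (Hom.col f p.1) (Hom.col g p.2))

lemma tensorMap_monomial {X Y X' Y' : DirectSumCompletion.{w} C} (e : X.ι → Y.ι)
    (φ : ∀ s, X.obj s ⟶ Y.obj (e s)) (e' : X'.ι → Y'.ι) (ψ : ∀ s, X'.obj s ⟶ Y'.obj (e' s)) :
    tensorMap (monomial e φ) (monomial e' ψ) =
      monomial (X := tensor X X') (Y := tensor Y Y') (fun p => (e p.1, e' p.2))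
        (fun p => φ p.1 ⊗ₘ ψ p.2) := by
  apply hom_ext
  intro p
  exact tensorCol_single _ _ _ _

lemma eq_tensor {X Y X' Y' : DirectSumCompletion.{w} C} {f : X ⟶ Y} {g : X' ⟶ Y'} {e : X.ι → Y.ι}
    {φ : ∀ s, X.obj s ⟶ Y.obj (e s)} {e' : X'.ι → Y'.ι} {ψ : ∀ s, X'.obj s ⟶ Y'.obj (e' s)}
    (hf : f = monomial e φ) (hg : g = monomial e' ψ) :
    tensorMap f g = monomial (X := tensor X X') (Y := tensor Y Y') (fun p => (e p.1, e' p.2))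
      (fun p => φ p.1 ⊗ₘ ψ p.2) := by
  rw [hf, hg, tensorMap_monomial]

lemma pre_tensorCol {X X' W W' : C} {Y Y' : DirectSumCompletion.{w} C} (f : W ⟶ X) (f' : W' ⟶ X')
    (x : Col X Y) (x' : Col X' Y') :
    pre (f ⊗ₘ f') (tensorCol x x') = tensorCol (pre f x) (pre f' x') := by
  induction x using col_induction with
  | zero => simp
  | add a b ha hb => simp only [map_add, AddMonoidHom.add_apply, ha, hb]
  | of t g =>
    induction x' using col_induction with
    | zero => simp
    | add a b ha hb => simp only [map_add, ha, hb]
    | of t' g' =>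
      rw [tensorCol_single, pre_single f, pre_single f', tensorCol_single]
      refine (pre_single (Y := tensor Y Y') _ _ _).trans ?_
      exact congrArg _ (MonoidalCategory.tensorHom_comp_tensorHom _ _ _ _)

lemma post_tensorCol {X X' : C} {Y Y' Z Z' : DirectSumCompletion.{w} C} (g : Y ⟶ Z) (g' : Y' ⟶ Z')
    (x : Col X Y) (x' : Col X' Y') :
    post (tensorMap g g') (tensorCol x x') = tensorCol (post g x) (post g' x') := by
  induction x using col_induction with
  | zero => simp
  | add a b ha hb => simp only [map_add, AddMonoidHom.add_apply, ha, hb]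
  | of t f =>
    induction x' using col_induction with
    | zero => simp
    | add a b ha hb => simp only [map_add, ha, hb]
    | of t' f' =>
      rw [tensorCol_single, post_single g, post_single g']
      exact (post_single (Y := tensor Y Y') (tensorMap g g') (t, t') (f ⊗ₘ f')).trans
        (pre_tensorCol f f' (Hom.col g t) (Hom.col g' t'))

/-- The tensor unit of the direct sum completion: the unit of `C`, as a one-term family. -/
abbrev unit : DirectSumCompletion.{w} C := ⟨PUnit, fun _ => 𝟙_ C⟩

/-- The associator, componentwise. -/
def assocIso (X Y Z : DirectSumCompletion.{w} C) :
    tensor (tensor X Y) Z ≅ tensor X (tensor Y Z) :=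
  monomialIso (X := tensor (tensor X Y) Z) (Y := tensor X (tensor Y Z))
    (fun p => (p.1.1, (p.1.2, p.2))) (fun p => (α_ (X.obj p.1.1) (Y.obj p.1.2) (Z.obj p.2)).hom)
    (fun p => ((p.1, p.2.1), p.2.2)) (fun p => (α_ (X.obj p.1) (Y.obj p.2.1) (Z.obj p.2.2)).inv)
    (monomial_congr fun _ => Iso.hom_inv_id _) (monomial_congr fun _ => Iso.inv_hom_id _)

/-- The left unitor, componentwise. -/
def leftUnitorIso (X : DirectSumCompletion.{w} C) : tensor unit X ≅ X :=
  monomialIso (X := tensor unit X) (fun p => p.2) (fun p => (λ_ (X.obj p.2)).hom)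
    (fun s => (PUnit.unit, s)) (fun s => (λ_ (X.obj s)).inv)
    (monomial_congr fun _ => Iso.hom_inv_id _) (monomial_congr fun _ => Iso.inv_hom_id _)

/-- The right unitor, componentwise. -/
def rightUnitorIso (X : DirectSumCompletion.{w} C) : tensor X unit ≅ X :=
  monomialIso (X := tensor X unit) (fun p => p.1) (fun p => (ρ_ (X.obj p.1)).hom)
    (fun s => (s, PUnit.unit)) (fun s => (ρ_ (X.obj s)).inv)
    (monomial_congr fun _ => Iso.hom_inv_id _) (monomial_congr fun _ => Iso.inv_hom_id _)

instance : MonoidalCategoryStruct (DirectSumCompletion.{w} C) where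
  tensorObj := tensor
  tensorHom := tensorMap
  whiskerLeft X _ _ f := tensorMap (𝟙 X) f
  whiskerRight f Y := tensorMap f (𝟙 Y)
  tensorUnit := unit
  associator := assocIso
  leftUnitor := leftUnitorIso
  rightUnitor := rightUnitorIso

lemma post_assoc {X X' X'' : C} {Y Y' Y'' : DirectSumCompletion.{w} C}
    (x : Col X Y) (x' : Col X' Y') (x'' : Col X'' Y'') :
    post (assocIso Y Y' Y'').hom (tensorCol (tensorCol x x') x'') =
      pre (α_ X X' X'').hom (tensorCol x (tensorCol x' x'')) := by
  induction x using col_induction with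
  | zero => simp
  | add a b ha hb => simp only [map_add, AddMonoidHom.add_apply, ha, hb]
  | of t f =>
    induction x' using col_induction with
    | zero => simp
    | add a b ha hb => simp only [map_add, AddMonoidHom.add_apply, ha, hb]
    | of t' f' =>
      induction x'' using col_induction with
      | zero => simp
      | add a b ha hb => simp only [map_add, ha, hb]
      | of t'' f'' =>
        rw [tensorCol_single, tensorCol_single (t := t')]
        refine (congrArg _ (tensorCol_single (Y := tensor Y Y') (t, t') t'' _ _)).trans ?_
        refine (post_single (Y := tensor (tensor Y Y') Y'') _ _ _).trans ?_
        refine (pre_single (Y := tensor Y (tensor Y' Y'')) _ _ _).trans ?_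
        refine Eq.trans ?_
          (congrArg _ (tensorCol_single (Y' := tensor Y' Y'') t (t', t'') _ _)).symm
        refine Eq.trans ?_ (pre_single (Y := tensor Y (tensor Y' Y'')) _ _ _).symm
        exact congrArg _ (MonoidalCategory.associator_naturality f f' f'')

lemma post_leftUnitor {X : C} {Y : DirectSumCompletion.{w} C} (x : Col X Y) :
    post (leftUnitorIso Y).hom (tensorCol (Y := unit) (single PUnit.unit (𝟙 (𝟙_ C))) x) =
      pre (λ_ X).hom x := by
  induction x using col_induction with
  | zero => simp
  | add a b ha hb => simp only [map_add, ha, hb]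
  | of t f =>
    rw [tensorCol_single, pre_single]
    refine (post_single (Y := tensor unit Y) _ _ _).trans ?_
    refine (pre_single _ _ _).trans ?_
    exact congrArg _ (by simp)

lemma post_rightUnitor {X : C} {Y : DirectSumCompletion.{w} C} (x : Col X Y) :
    post (rightUnitorIso Y).hom (tensorCol (Y' := unit) x (single PUnit.unit (𝟙 (𝟙_ C)))) =
      pre (ρ_ X).hom x := by
  induction x using col_induction with
  | zero => simp
  | add a b ha hb => simp only [map_add, AddMonoidHom.add_apply, ha, hb]
  | of t f =>
    rw [tensorCol_single, pre_single]
    refine (post_single (Y := tensor Y unit) _ _ _).trans ?_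
    refine (pre_single _ _ _).trans ?_
    exact congrArg _ (by simp)

lemma tensorMap_id (X Y : DirectSumCompletion.{w} C) :
    tensorMap (𝟙 X) (𝟙 Y) = 𝟙 (tensor X Y) := by
  rw [id_eq_monomial X, id_eq_monomial Y, tensorMap_monomial]
  exact monomial_congr fun p => MonoidalCategory.id_tensorHom_id _ _

lemma pentagon' (W X Y Z : DirectSumCompletion.{w} C) :
    tensorMap (assocIso W X Y).hom (𝟙 Z) ≫ (assocIso W (tensor X Y) Z).hom ≫
        tensorMap (𝟙 W) (assocIso X Y Z).hom =
      (assocIso (tensor W X) Y Z).hom ≫ (assocIso W X (tensor Y Z)).hom :=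
  eq_of_eq_monomial (eq_comp (eq_tensor rfl rfl) (eq_comp rfl (eq_tensor rfl rfl)))
    (eq_comp rfl rfl) fun p => by
      simp

lemma triangle' (X Y : DirectSumCompletion.{w} C) :
    (assocIso X unit Y).hom ≫ tensorMap (𝟙 X) (leftUnitorIso Y).hom =
      tensorMap (rightUnitorIso X).hom (𝟙 Y) :=
  eq_of_eq_monomial (eq_comp rfl (eq_tensor rfl rfl)) (eq_tensor rfl rfl) fun p => by
    simp

/-- The direct sum completion is monoidal, with the componentwise structure isomorphisms. -/
instance : MonoidalCategory (DirectSumCompletion.{w} C) :=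
  MonoidalCategory.ofTensorHom
    (id_tensorHom_id := tensorMap_id)
    (id_tensorHom := fun _ _ _ _ => rfl)
    (tensorHom_id := fun _ _ => rfl)
    (tensorHom_comp_tensorHom := fun _ _ g₁ g₂ => hom_ext fun _ => post_tensorCol g₁ g₂ _ _)
    (associator_naturality := fun {X₁ X₂ X₃ _ _ _} f₁ f₂ f₃ => hom_ext fun p =>
      (post_assoc _ _ _).trans (post_single (Y := tensor X₁ (tensor X₂ X₃))
        (tensorMap f₁ (tensorMap f₂ f₃)) (p.1.1, (p.1.2, p.2)) (α_ _ _ _).hom).symm)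
    (leftUnitor_naturality := fun f => hom_ext fun _ =>
      (post_leftUnitor _).trans (post_single f _ _).symm)
    (rightUnitor_naturality := fun f => hom_ext fun _ =>
      (post_rightUnitor _).trans (post_single f _ _).symm)
    (pentagon := pentagon')
    (triangle := triangle')

instance : MonoidalPreadditive (DirectSumCompletion.{w} C) where
  whiskerLeft_zero {X Y Z} := hom_ext (X := tensor X Y) (Y := tensor X Z) fun p =>
    map_zero (tensorCol (single p.1 (𝟙 (X.obj p.1))))
  zero_whiskerRight {X Y Z} := hom_ext (X := tensor Y X) (Y := tensor Z X) fun p =>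
    DFunLike.congr_fun (map_zero tensorCol) (single p.2 (𝟙 (X.obj p.2)))
  whiskerLeft_add {X Y Z} f g := hom_ext (X := tensor X Y) (Y := tensor X Z) fun p =>
    map_add (tensorCol (single p.1 (𝟙 (X.obj p.1)))) (Hom.col f p.2) (Hom.col g p.2)
  add_whiskerRight {X Y Z} f g := hom_ext (X := tensor Y X) (Y := tensor Z X) fun p =>
    DFunLike.congr_fun (map_add tensorCol (Hom.col f p.1) (Hom.col g p.1))
      (single p.2 (𝟙 (X.obj p.2)))

end Monoidal

section Braided

variable {C : Type u} [Category.{v} C] [Preadditive C] [MonoidalCategory C] [MonoidalPreadditive C]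
  [BraidedCategory C]

/-- The braiding, componentwise. -/
def braidIso (X Y : DirectSumCompletion.{w} C) : tensor X Y ≅ tensor Y X :=
  monomialIso (X := tensor X Y) (Y := tensor Y X)
    (fun p => (p.2, p.1)) (fun p => (β_ (X.obj p.1) (Y.obj p.2)).hom)
    (fun p => (p.2, p.1)) (fun p => (β_ (X.obj p.2) (Y.obj p.1)).inv)
    (monomial_congr fun _ => Iso.hom_inv_id _) (monomial_congr fun _ => Iso.inv_hom_id _)

lemma post_braid {X X' : C} {Y Y' : DirectSumCompletion.{w} C} (x : Col X Y) (x' : Col X' Y') :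
    post (braidIso Y Y').hom (tensorCol x x') = pre (β_ X X').hom (tensorCol x' x) := by
  induction x using col_induction with
  | zero => simp
  | add a b ha hb => simp only [map_add, AddMonoidHom.add_apply, ha, hb]
  | of t f =>
    induction x' using col_induction with
    | zero => simp
    | add a b ha hb => simp only [map_add, AddMonoidHom.add_apply, ha, hb]
    | of t' f' =>
      rw [tensorCol_single, tensorCol_single]
      refine (post_single (Y := tensor Y Y') _ _ _).trans ?_
      refine (pre_single (Y := tensor Y' Y) _ _ _).trans ?_
      refine Eq.trans ?_ (pre_single (Y := tensor Y' Y) _ _ _).symm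
      exact congrArg _ (BraidedCategory.braiding_naturality f f')

lemma tensorMap_braid {X X' Y Y' : DirectSumCompletion.{w} C} (f : X ⟶ Y) (g : X' ⟶ Y') :
    tensorMap f g ≫ (braidIso Y Y').hom = (braidIso X X').hom ≫ tensorMap g f :=
  hom_ext fun p => (post_braid _ _).trans
    (post_single (Y := tensor X' X) (tensorMap g f) (p.2, p.1) (β_ _ _).hom).symm

lemma hexagon_forward' (X Y Z : DirectSumCompletion.{w} C) :
    (assocIso X Y Z).hom ≫ (braidIso X (tensor Y Z)).hom ≫ (assocIso Y Z X).hom =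
      tensorMap (braidIso X Y).hom (𝟙 Z) ≫ (assocIso Y X Z).hom ≫
        tensorMap (𝟙 Y) (braidIso X Z).hom :=
  eq_of_eq_monomial (eq_comp rfl (eq_comp rfl rfl))
    (eq_comp (eq_tensor rfl rfl) (eq_comp rfl (eq_tensor rfl rfl))) fun p => by
      simpa only [id_tensorHom, tensorHom_id] using
        BraidedCategory.hexagon_forward (X.obj p.1.1) (Y.obj p.1.2) (Z.obj p.2)

lemma hexagon_reverse' (X Y Z : DirectSumCompletion.{w} C) :
    (assocIso X Y Z).inv ≫ (braidIso (tensor X Y) Z).hom ≫ (assocIso Z X Y).inv =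
      tensorMap (𝟙 X) (braidIso Y Z).hom ≫ (assocIso X Z Y).inv ≫
        tensorMap (braidIso X Z).hom (𝟙 Y) :=
  eq_of_eq_monomial (eq_comp rfl (eq_comp rfl rfl))
    (eq_comp (eq_tensor rfl rfl) (eq_comp rfl (eq_tensor rfl rfl))) fun p => by
      simpa only [id_tensorHom, tensorHom_id] using
        BraidedCategory.hexagon_reverse (X.obj p.1) (Y.obj p.2.1) (Z.obj p.2.2)

/-- The direct sum completion is braided, with the componentwise braiding. -/
instance : BraidedCategory (DirectSumCompletion.{w} C) where
  braiding X Y := braidIso (C := C) X Y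
  braiding_naturality_right X _ _ f := tensorMap_braid (𝟙 X) f
  braiding_naturality_left f Z := tensorMap_braid f (𝟙 Z)
  hexagon_forward := hexagon_forward'
  hexagon_reverse := hexagon_reverse'

end Braided

end DirectSumCompletion

/-! ## Modules over an algebra object -/

section Modules

variable {D : Type u} [Category.{v} D] [Preadditive D] [MonoidalCategory D] [MonoidalPreadditive D]

/-- The zero morphism of `D` is a morphism of `A`-modules. -/
instance (A : D) [MonObj A] (X Y : D) [ModObj A X] [ModObj A Y] : IsModHom A (0 : X ⟶ Y) where
  smul_hom := by simp

instance (A : D) [MonObj A] : HasZeroMorphisms (Mod D A) where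
  zero X Y := ⟨Mod.Hom.mk (0 : X.X ⟶ Y.X)⟩
  comp_zero f Z := by
    apply Mod.hom_ext
    exact comp_zero
  zero_comp X {Y Z} f := by
    apply Mod.hom_ext
    exact zero_comp

/-- The induced module `F_A(W) = A ⊗ W`, with `A` acting by multiplication on the left factor. -/
def inducedModule (A : D) [MonObj A] (W : D) : Mod D A :=
  letI : ModObj A (A ⊗ W) :=
    { smul := (α_ A A W).inv ≫ MonObj.mul ▷ W
      one_smul := by
        simp [← comp_whiskerRight]
      mul_smul := by
        have h := congrArg (fun f => (α_ (A ⊗ A) A W).inv ≫ f ▷ W) (MonObj.mul_assoc A)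
        simp only [comp_whiskerRight] at h
        simp only [selfLeftAction_actionHomLeft, selfLeftAction_actionHomRight,
          selfLeftAction_actionAssocIso, Category.assoc, MonoidalCategory.whiskerLeft_comp]
        rw [associator_inv_naturality_left_assoc, h]
        simp }
  ⟨A ⊗ W⟩

/-- An `A`-module `X` is local if its action is invariant under the monodromy of `A` and `X`. -/
def isLocalModule [BraidedCategory D] (A : D) [MonObj A] : ObjectProperty (Mod D A) :=
  fun X => (β_ A X.X).hom ≫ (β_ X.X A).hom ≫ ModObj.smul (M := A) (X := X.X) =
    ModObj.smul (M := A) (X := X.X)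

/-- The category of local `A`-modules, a full subcategory of the category of `A`-modules. -/
abbrev LocalModule [BraidedCategory D] (A : D) [MonObj A] := (isLocalModule A).FullSubcategory

/-! ## Supercommutative algebra objects -/

/-- A decomposition `X = X⁰ ⊕ X¹` into an even and an odd part. -/
structure ParityDecomposition (X : D) where
  /-- The even part `part 0` and the odd part `part 1`. -/
  part : ZMod 2 → D
  /-- The inclusions. -/
  incl : ∀ a, part a ⟶ X
  /-- The projections. -/
  proj : ∀ a, X ⟶ part a
  incl_proj_self : ∀ a, incl a ≫ proj a = 𝟙 (part a)
  incl_proj_ne : ∀ a b, a ≠ b → incl a ≫ proj b = 0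
  total : proj 0 ≫ incl 0 + proj 1 ≫ incl 1 = 𝟙 X

/-- An associative unital algebra object `A = A⁰ ⊕ A¹` is a supercommutative algebra if its unit and
its multiplication are even and `μ ∘ β = (-1)^{ab} μ` on `A^a ⊗ A^b`. -/
structure IsSupercommutative [BraidedCategory D] (A : D) [MonObj A] (P : ParityDecomposition A) :
    Prop where
  one_even : (MonObj.one : 𝟙_ D ⟶ A) ≫ P.proj 1 = 0
  mul_even : ∀ a b c, c ≠ a + b → (P.incl a ⊗ₘ P.incl b) ≫ MonObj.mul ≫ P.proj c = 0
  mul_comm : ∀ a b, (P.incl a ⊗ₘ P.incl b) ≫ (β_ A A).hom ≫ MonObj.mul =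
    (if a = 1 ∧ b = 1 then (-1 : ℤ) else 1) • ((P.incl a ⊗ₘ P.incl b) ≫ MonObj.mul)

end Modules

/-! ## Semisimplicity -/

/-- An abelian category is semisimple if every object is a finite direct sum of simple objects. -/
def IsSemisimpleAbelian (C : Type u) [Category.{v} C] [Abelian C] : Prop :=
  ∀ X : C, ∃ (n : ℕ) (S : Fin n → C) (i : ∀ k, S k ⟶ X),
    (∀ k, Simple (S k)) ∧ Nonempty (IsColimit (Cofan.mk X i))

/-- An object is completely reducible if it is a direct sum (that is, a coproduct), indexed by an
arbitrary set, of simple objects. -/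
def IsCompletelyReducible {E : Type u} [Category.{v} E] [HasZeroMorphisms E] (X : E) : Prop :=
  ∃ (K : Type w) (S : K → E) (i : ∀ k, S k ⟶ X),
    (∀ k, Simple (S k)) ∧ Nonempty (IsColimit (Cofan.mk X i))

/-! ## Simple current extensions -/

section SimpleCurrents

variable {C : Type u} [Category.{v} C] [Preadditive C] [MonoidalCategory C]

/-- A simple current: an invertible object. -/
def IsSimpleCurrent (J : C) : Prop := ∃ J' : C, Nonempty (J ⊗ J' ≅ 𝟙_ C)

/-- `M` is a fixed point of the family `J` if `J i ⊗ M ≅ J j ⊗ M` for some `J i ≇ J j`. -/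
def IsFixedPoint {I : Type w} (J : I → C) (M : C) : Prop :=
  ∃ i j, IsEmpty (J i ≅ J j) ∧ Nonempty (J i ⊗ M ≅ J j ⊗ M)

/-- No simple object is a fixed point of the family `J`. -/
def IsFixedPointFree {I : Type w} (J : I → C) : Prop :=
  ∀ M : C, Simple M → ¬ IsFixedPoint J M

/-- `A` is a simple current extension in the direct sum completion of `C`: a supercommutative
algebra object that is simple as a module over itself and is the direct sum of the pairwise
non-isomorphic simple currents `J i` of `C`. -/
structure IsSimpleCurrentExtension [MonoidalPreadditive C] [BraidedCategory C]
    (A : DirectSumCompletion.{w} C) [MonObj A] (P : ParityDecomposition A) {I : Type w}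
    (J : I → C) : Prop where
  supercommutative : IsSupercommutative A P
  simple : Simple (Mod.regular A)
  simpleCurrent : ∀ i, IsSimpleCurrent (J i)
  inequivalent : ∀ i j, i ≠ j → IsEmpty (J i ≅ J j)
  decomposition : Nonempty (A ≅ ⟨I, J⟩)

end SimpleCurrents

end

/-! Every `A`-module is shown to be induced from a sum of simple objects; both claims follow from
this. Modules are handled through generalized elements: a column `Col N X` is a morphism from an
object `N` of `C` to `X`, and `act` and `mulCol` multiply such elements.

Two facts about `A` carry the argument. First, simplicity of `A` over itself makes the tensor unit
of `C` simple (`simple_unit`), hence every simple current is simple. Second, every summand `J i` is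
invertible inside `A` (`exists_mulCol_eq_oneCol`): the left ideal generated by `J i` is all of `A`,
so some product `J l · J i` contains the unit. Acting with `J i` on a module can therefore be undone
by acting with `J l` (`exists_pre_act_act`).

Fixed-point freeness makes the objects `J i ⊗ M`, for `M` simple, pairwise non-isomorphic, so by
Schur's lemma a nonzero morphism from a simple object to `A ⊗ M` is an isomorphism onto a single `J
i ⊗ M`. Given a module `X`, Zorn's lemma yields a maximal family of simple subobjects `M t` of `X`
for which `⨁ A ⊗ M t ⟶ X` is injective. If adding a further `M e` creates a relation, its `M e`-part
involves a single `J i · M e`, which lies in the submodule already generated; undoing `J i` puts `M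
e` there too. Hence the map is an isomorphism (`exists_isIso_inducedDesc`).

By the same inversion, a nonzero map between modules induced from simple objects splits
(`isSplitEpi_of_ne_zero`). So a local module `A ⊗ M` with `M` simple is a simple local module, and
decomposing `W` in `X ≅ A ⊗ W` decomposes a local `X` into such modules. -/

noncomputable section

/-! ### Induced modules as free modules -/

section Modules

variable {D : Type u} [Category.{v} D] [MonoidalCategory D] {A : D} [MonObj A]

/-- Morphisms out of an induced module. -/
def inducedDesc {W : D} (X : Mod D A)
    (x : W ⟶ X.X) : inducedModule A W ⟶ X :=
  Mod.Hom.mk' (M := inducedModule A W) (A ◁ x ≫ ModObj.smul (M := A) (X := X.X)) (by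
    change ((α_ A A W).inv ≫ MonObj.mul ▷ W) ≫ A ◁ x ≫ ModObj.smul (M := A) (X := X.X) =
      A ◁ (A ◁ x ≫ ModObj.smul (M := A) (X := X.X)) ≫ ModObj.smul (M := A) (X := X.X)
    rw [MonoidalCategory.whiskerLeft_comp, Category.assoc, Category.assoc,
      ModObj.mul_smul_self_flip, ← whisker_exchange_assoc]
    simp)

lemma inducedDesc_hom {W : D} (X : Mod D A)
    (x : W ⟶ X.X) :
    (inducedDesc X x).hom = (A ◁ x ≫ ModObj.smul (M := A) (X := X.X) : A ⊗ W ⟶ X.X) := rfl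

variable (A) in
/-- The inclusion of `W` into the induced module `A ⊗ W`. -/
def inducedUnit (W : D) : W ⟶ (inducedModule A W).X :=
  ((λ_ W).inv ≫ MonObj.one ▷ W : W ⟶ A ⊗ W)

lemma inducedUnit_inducedDesc {W : D}
    (X : Mod D A) (x : W ⟶ X.X) :
    inducedUnit A W ≫ (inducedDesc X x).hom = x := by
  rw [inducedDesc_hom]
  change ((λ_ W).inv ≫ MonObj.one ▷ W) ≫ A ◁ x ≫ ModObj.smul (M := A) (X := X.X) = x
  rw [Category.assoc, ← whisker_exchange_assoc, ModObj.one_smul_self]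
  simp

/-- In elements, `a ⊗ w = a · (1 ⊗ w)`, so a module map is recovered from its values on the
generators `1 ⊗ w`. With `inducedUnit_inducedDesc` this is the free-forgetful adjunction. -/
lemma inducedDesc_inducedUnit {W : D}
    {X : Mod D A} (f : inducedModule A W ⟶ X) :
    inducedDesc X (inducedUnit A W ≫ f.hom) = f := by
  apply Mod.hom_ext
  rw [inducedDesc_hom]
  have h : ((α_ A A W).inv ≫ MonObj.mul ▷ W) ≫ f.hom =
      A ◁ f.hom ≫ ModObj.smul (M := A) (X := X.X) :=
    IsModHom.smul_hom (A := A) (f := f.hom)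
  rw [MonoidalCategory.whiskerLeft_comp, Category.assoc, ← h]
  change A ◁ ((λ_ W).inv ≫ MonObj.one ▷ W) ≫ ((α_ A A W).inv ≫ MonObj.mul ▷ W) ≫ f.hom = f.hom
  have h2 : A ◁ ((λ_ W).inv ≫ MonObj.one ▷ W) ≫ ((α_ A A W).inv ≫ MonObj.mul ▷ W) =
      𝟙 (A ⊗ W) := by
    have h3 := congrArg (fun f => f ▷ W) (MonObj.mul_one A)
    simp only [comp_whiskerRight] at h3
    rw [MonoidalCategory.whiskerLeft_comp, Category.assoc, associator_inv_naturality_middle_assoc,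
      h3]
    simp
  exact (Category.assoc _ _ _).symm.trans
    ((congrArg (fun g => g ≫ f.hom) h2).trans (Category.id_comp _))

/-- Morphisms out of an induced module are determined by their restriction to the generators. -/
lemma induced_hom_ext {W : D} {X : Mod D A}
    {f g : inducedModule A W ⟶ X} (h : inducedUnit A W ≫ f.hom = inducedUnit A W ≫ g.hom) :
    f = g := by
  rw [← inducedDesc_inducedUnit f, h, inducedDesc_inducedUnit]

end Modules

/-! ### Columns as generalized elements -/

namespace DirectSumCompletion

section Preadditive

variable {C : Type u} [Category.{v} C] [Preadditive C]

lemma post_id {X : C} {Y : DirectSumCompletion.{w} C} (x : Col X Y) : post (𝟙 Y) x = x := by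
  induction x using col_induction with
  | zero => simp
  | of t f => simp
  | add a b ha hb => simp only [map_add, ha, hb]

lemma post_comp {X : C} {Y Z W : DirectSumCompletion.{w} C} (g : Y ⟶ Z) (h : Z ⟶ W)
    (x : Col X Y) : post (g ≫ h) x = post h (post g x) := by
  induction x using col_induction with
  | zero => simp
  | of t f => simp [post_pre]
  | add a b ha hb => simp only [map_add, ha, hb]

lemma single_apply_self {X : C} {Y : DirectSumCompletion.{w} C} (t : Y.ι) (f : X ⟶ Y.obj t) :
    (single t f : Col X Y) t = f := by
  let := Classical.decEq Y.ι
  exact DirectSum.of_eq_same (β := fun t => X ⟶ Y.obj t) t f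

lemma single_apply_of_ne {X : C} {Y : DirectSumCompletion.{w} C} {t t' : Y.ι} (h : t' ≠ t)
    (f : X ⟶ Y.obj t) : (single t f : Col X Y) t' = 0 := by
  let := Classical.decEq Y.ι
  exact DirectSum.of_eq_of_ne (β := fun t => X ⟶ Y.obj t) t t' f h

lemma eq_single_of_forall_ne {X : C} {Y : DirectSumCompletion.{w} C} (x : Col X Y) (t : Y.ι)
    (h : ∀ t', t' ≠ t → x t' = 0) : x = single t (x t) := by
  refine DFinsupp.ext fun t' => ?_
  by_cases ht : t' = t
  · subst ht
    exact (single_apply_self t' _).symm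
  · exact (h t' ht).trans (single_apply_of_ne ht _).symm

/-- The formal direct sum with a single summand. -/
abbrev of (X : C) : DirectSumCompletion.{w} C := ⟨PUnit, fun _ => X⟩

/-- The morphism out of a formal direct sum with a single summand given by a column. -/
def ofCol {X : C} {Y : DirectSumCompletion.{w} C} (x : Col X Y) : of X ⟶ Y :=
  Hom.mk (X := of X) fun _ => x

/-- The inclusion of a summand into an object that decomposes as a direct sum. -/
abbrev gen {A : DirectSumCompletion.{w} C} {I : Type w} {J : I → C} (θ : A ≅ ⟨I, J⟩) (i : I) :
    Col (J i) A :=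
  Hom.col θ.inv i

lemma post_gen {A : DirectSumCompletion.{w} C} {I : Type w} {J : I → C} (θ : A ≅ ⟨I, J⟩) (i : I) :
    post θ.hom (gen θ i) = single (Y := ⟨I, J⟩) i (𝟙 (J i)) := by
  exact congrFun (congrArg Hom.col θ.inv_hom_id) i

/-- Every column of a direct sum is a combination of the inclusions of the summands. -/
lemma col_induction_of_iso {I : Type w} {J : I → C} {A : DirectSumCompletion.{w} C}
    (θ : A ≅ ⟨I, J⟩) {X : C} {p : Col X A → Prop} (x : Col X A) (zero : p 0)
    (gen : ∀ i (f : X ⟶ J i), p (pre f (gen θ i)))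
    (add : ∀ a b, p a → p b → p (a + b)) : p x := by
  have key : ∀ y : Col X (⟨I, J⟩ : DirectSumCompletion.{w} C), p (post θ.inv y) := by
    intro y
    induction y using col_induction with
    | zero => simpa using zero
    | of t f =>
      rw [post_single (Y := ⟨I, J⟩)]
      exact gen t f
    | add a b ha hb => simpa using add _ _ ha hb
  have h := key (post θ.hom x)
  rwa [← post_comp, θ.hom_inv_id, post_id] at h

/-- A morphism that is bijective on columns is an isomorphism. -/
lemma isIso_of_bijective {X Y : DirectSumCompletion.{w} C} (f : X ⟶ Y)
    (inj : ∀ N : C, ∀ x : Col N X, post f x = 0 → x = 0)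
    (surj : ∀ N : C, ∀ y : Col N Y, ∃ x : Col N X, post f x = y) : IsIso f := by
  -- Preimages of the inclusions of the summands of `Y` assemble to a section of `f`; injectivity
  -- then makes it a two-sided inverse.
  choose g hg using fun t => surj _ (single t (𝟙 (Y.obj t)))
  have h : (Hom.mk g : Y ⟶ X) ≫ f = 𝟙 Y := hom_ext hg
  refine ⟨Hom.mk g, hom_ext fun s => ?_, h⟩
  rw [← sub_eq_zero]
  apply inj
  rw [map_sub, ← comp_col, ← comp_col, Category.assoc, h, Category.comp_id, Category.id_comp,
    sub_self]

end Preadditive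

/-! ### Element calculus for algebras and modules -/

section Monoidal

variable {C : Type u} [Category.{v} C] [Preadditive C] [MonoidalCategory C] [MonoidalPreadditive C]
variable {A : DirectSumCompletion.{w} C} [MonObj A]

/-- The action of columns of an algebra on columns of a module. -/
def act (X : Mod (DirectSumCompletion.{w} C) A) {U V : C} :
    Col U A →+ Col V X.X →+ Col (U ⊗ V) X.X :=
  (AddMonoidHom.compHom (post (Y := tensor A X.X) (ModObj.smul (M := A) (X := X.X)))).comp tensorCol

/-- The product of columns of an algebra. -/
def mulCol {U V : C} : Col U A →+ Col V A →+ Col (U ⊗ V) A :=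
  (AddMonoidHom.compHom (post (Y := tensor A A) (MonObj.mul (X := A)))).comp tensorCol

variable (A) in
/-- The unit of an algebra, as a column. -/
def oneCol : Col (𝟙_ C) A := Hom.col (X := unit) (MonObj.one : 𝟙_ _ ⟶ A) PUnit.unit

lemma act_apply (X : Mod (DirectSumCompletion.{w} C) A) {U V : C} (a : Col U A) (x : Col V X.X) :
    act X a x = post (Y := tensor A X.X) (ModObj.smul (M := A) (X := X.X)) (tensorCol a x) := rfl

lemma pre_act (X : Mod (DirectSumCompletion.{w} C) A) {U V U' V' : C} (φ : U' ⟶ U) (ψ : V' ⟶ V)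
    (a : Col U A) (x : Col V X.X) :
    act X (pre φ a) (pre ψ x) = pre (φ ⊗ₘ ψ) (act X a x) := by
  rw [act_apply, act_apply, ← post_pre, pre_tensorCol]

lemma act_mulCol (X : Mod (DirectSumCompletion.{w} C) A) {U V W : C} (a : Col U A) (b : Col V A)
    (x : Col W X.X) :
    act X (mulCol a b) x = pre (α_ U V W).hom (act X a (act X b x)) := by
  have h := congrArg (fun f : tensor (tensor A A) X.X ⟶ X.X =>
    post f (tensorCol (tensorCol a b) x)) (ModObj.mul_smul_self A X.X)
  have h1 := (post_comp (Y := tensor (tensor A A) X.X) (Z := tensor A X.X)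
    (tensorMap MonObj.mul (𝟙 X.X)) (ModObj.smul (M := A) (X := X.X))
    (tensorCol (tensorCol a b) x)).symm.trans h
  rw [post_tensorCol, post_id] at h1
  refine h1.trans ?_
  refine (post_comp (Y := tensor (tensor A A) X.X) (Z := tensor A (tensor A X.X))
    (assocIso A A X.X).hom _ _).trans ?_
  rw [post_assoc, post_pre]
  congr 1
  refine (post_comp (Y := tensor A (tensor A X.X)) (Z := tensor A X.X)
    (tensorMap (𝟙 A) (ModObj.smul (M := A) (X := X.X))) _ _).trans ?_
  rw [post_tensorCol, post_id]
  rfl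

lemma act_oneCol (X : Mod (DirectSumCompletion.{w} C) A) {V : C} (x : Col V X.X) :
    act X (oneCol A) x = pre (λ_ V).hom x := by
  have h := congrArg (fun f : tensor unit X.X ⟶ X.X =>
    post f (tensorCol (Y := unit) (single PUnit.unit (𝟙 (𝟙_ C))) x)) (ModObj.one_smul_self A X.X)
  have h1 := (post_comp (Y := tensor unit X.X) (Z := tensor A X.X)
    (tensorMap MonObj.one (𝟙 X.X)) (ModObj.smul (M := A) (X := X.X)) _).symm.trans h
  rw [post_tensorCol, post_id, post_single, pre_id] at h1
  exact h1.trans (post_leftUnitor x)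

lemma post_act {X Y : Mod (DirectSumCompletion.{w} C) A} (f : X ⟶ Y) {U V : C} (a : Col U A)
    (x : Col V X.X) : post f.hom (act X a x) = act Y a (post f.hom x) := by
  have h := congrArg (fun f : tensor A X.X ⟶ Y.X => post f (tensorCol a x))
    (IsModHom.smul_hom (A := A) (f := f.hom))
  refine (post_comp (Y := tensor A X.X) _ _ _).symm.trans (h.trans ?_)
  refine (post_comp (Y := tensor A X.X) (Z := tensor A Y.X) (tensorMap (𝟙 A) f.hom) _ _).trans ?_
  rw [post_tensorCol, post_id]
  rfl

lemma pre_leftUnitor_inv_act (X : Mod (DirectSumCompletion.{w} C) A) {V : C} (x : Col V X.X) :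
    pre (λ_ V).inv (act X (oneCol A) x) = x := by
  rw [act_oneCol, pre_pre, Iso.inv_hom_id, pre_id]

lemma pre_mulCol {U V U' V' : C} (φ : U' ⟶ U) (ψ : V' ⟶ V) (a : Col U A) (b : Col V A) :
    mulCol (pre φ a) (pre ψ b) = pre (φ ⊗ₘ ψ) (mulCol a b) :=
  pre_act (Mod.regular A) φ ψ a b

lemma mulCol_assoc {U V W : C} (a : Col U A) (b : Col V A) (c : Col W A) :
    mulCol (mulCol a b) c = pre (α_ U V W).hom (mulCol a (mulCol b c)) :=
  act_mulCol (Mod.regular A) a b c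

lemma pre_leftUnitor_inv_mulCol {V : C} (a : Col V A) :
    pre (λ_ V).inv (mulCol (oneCol A) a) = a :=
  pre_leftUnitor_inv_act (Mod.regular A) a

lemma post_inducedDesc {W : DirectSumCompletion.{w} C} (X : Mod (DirectSumCompletion.{w} C) A)
    (x : W ⟶ X.X) {U V : C} (a : Col U A) (y : Col V W) :
    post (Y := tensor A W) (inducedDesc X x).hom (tensorCol a y) = act X a (post x y) := by
  refine (post_comp (Y := tensor A W) (Z := tensor A X.X) (tensorMap (𝟙 A) x) _ _).trans ?_
  rw [post_tensorCol, post_id]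
  rfl

/-- This is `a · (1 ⊗ y) = a ⊗ y`; it identifies the summand `J i ⊗ N` of `A ⊗ N` with `J i` acting
on the generator. -/
lemma act_inducedUnit {W : DirectSumCompletion.{w} C} {U V : C} (a : Col U A) (y : Col V W) :
    act (inducedModule A W) a (post (inducedUnit A W) y) =
      (tensorCol a y : Col (U ⊗ V) (tensor A W)) := by
  rw [← post_inducedDesc]
  have h := inducedDesc_inducedUnit (𝟙 (inducedModule A W))
  rw [Mod.id_hom', Category.comp_id] at h
  rw [h]
  exact post_id _

end Monoidal

end DirectSumCompletion

/-! ### Tensoring with an invertible object -/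

section SimpleCurrents

variable {C : Type u} [Category.{v} C] [MonoidalCategory C] [BraidedCategory C]

/-- Tensoring with a simple current is an equivalence of categories. -/
lemma IsSimpleCurrent.isEquivalence_tensorLeft {J : C} (hJ : IsSimpleCurrent J) :
    (tensorLeft J).IsEquivalence := by
  obtain ⟨J', ⟨e⟩⟩ := hJ
  have e' : J' ⊗ J ≅ 𝟙_ C := β_ J' J ≪≫ e
  have unit : 𝟭 C ≅ tensorLeft J ⋙ tensorLeft J' := NatIso.ofComponents
    (fun X => (λ_ X).symm ≪≫ whiskerRightIso e'.symm X ≪≫ α_ J' J X)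
    (fun f => by
      dsimp
      simp only [Category.assoc, whiskerRightIso_hom, Iso.symm_hom]
      rw [leftUnitor_inv_naturality_assoc, whisker_exchange_assoc, associator_naturality_right])
  have counit : tensorLeft J' ⋙ tensorLeft J ≅ 𝟭 C := NatIso.ofComponents
    (fun X => (α_ J J' X).symm ≪≫ whiskerRightIso e X ≪≫ λ_ X)
    (fun f => by
      dsimp
      simp only [Category.assoc, whiskerRightIso_hom]
      rw [associator_inv_naturality_right_assoc, whisker_exchange_assoc, leftUnitor_naturality])
  exact (CategoryTheory.Equivalence.mk (tensorLeft J) (tensorLeft J') unit counit).isEquivalence_functor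

lemma IsSimpleCurrent.whiskerLeft_injective {J : C} (hJ : IsSimpleCurrent J) {X Y : C}
    {f g : X ⟶ Y} (h : J ◁ f = J ◁ g) : f = g :=
  have := hJ.isEquivalence_tensorLeft
  (tensorLeft J).map_injective h

lemma IsSimpleCurrent.simple_tensor {J : C} (hJ : IsSimpleCurrent J) [HasZeroMorphisms C] (M : C)
    [Simple M] : Simple (J ⊗ M) :=
  have := hJ.isEquivalence_tensorLeft
  simple_obj (tensorLeft J) M

lemma IsSimpleCurrent.simple [HasZeroMorphisms C] [Simple (𝟙_ C)] {J : C}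
    (hJ : IsSimpleCurrent J) : Simple J :=
  have := hJ.simple_tensor (𝟙_ C)
  Simple.of_iso (ρ_ J).symm

end SimpleCurrents

/-! ### Semisimplicity and Schur's lemma for columns -/

section Semisimple

variable {C : Type u} [Category.{v} C] [Abelian C]

/-- In a semisimple category the identity of every object is a finite sum of projections onto simple
summands. -/
lemma IsSemisimpleAbelian.exists_retracts (hC : IsSemisimpleAbelian C) (X : C) :
    ∃ (n : ℕ) (S : Fin n → C) (i : ∀ k, S k ⟶ X) (p : ∀ k, X ⟶ S k),
      (∀ k, Simple (S k)) ∧ (∀ k, i k ≫ p k = 𝟙 (S k)) ∧ ∑ k, p k ≫ i k = 𝟙 X := by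
  obtain ⟨n, S, i, hS, ⟨hc⟩⟩ := hC X
  -- Kronecker delta morphisms, from which the universal property of the coproduct builds the
  -- projections. The `eqToHom` is needed because `S l` and `S k` have different types of endpoints
  -- until `l = k` is used.
  have h : ∀ k l, ∃ f : S l ⟶ S k, (∀ h : l = k, f = eqToHom (h ▸ rfl)) ∧ (l ≠ k → f = 0) := by
    intro k l
    by_cases hkl : l = k
    · exact ⟨eqToHom (hkl ▸ rfl), fun _ => rfl, fun h => (h hkl).elim⟩
    · exact ⟨0, fun h => (hkl h).elim, fun _ => rfl⟩
  choose d hd hd' using h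
  have hp : ∀ k l, i l ≫ Cofan.IsColimit.desc hc (d k) = d k l := fun k l =>
    Cofan.IsColimit.fac hc (d k) l
  refine ⟨n, S, i, fun k => Cofan.IsColimit.desc hc (d k), hS, fun k => ?_, ?_⟩
  · rw [hp, hd k k rfl]
    rfl
  · refine Cofan.IsColimit.hom_ext hc _ _ fun l => ?_
    change i l ≫ _ = i l ≫ _
    rw [Preadditive.comp_sum, Category.comp_id, Finset.sum_eq_single l]
    · rw [← Category.assoc, hp, hd l l rfl]
      exact Category.id_comp _
    · intro k _ hkl
      rw [← Category.assoc, hp, hd' k l (Ne.symm hkl), zero_comp]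
    · simp

end Semisimple

namespace DirectSumCompletion

variable {C : Type u} [Category.{v} C] [Abelian C]

/-- By Schur's lemma two nonzero entries are both isomorphisms from `U`, so the two summands would
be isomorphic. -/
lemma eq_of_apply_ne_zero {U : C} [Simple U] {Y : DirectSumCompletion.{w} C}
    {x : Col U Y} {t t' : Y.ι} [Simple (Y.obj t)] [Simple (Y.obj t')]
    (hY : t ≠ t' → IsEmpty (Y.obj t ≅ Y.obj t')) (h : x t ≠ 0) (h' : x t' ≠ 0) : t = t' := by
  by_contra hne
  have := isIso_of_hom_simple h
  have := isIso_of_hom_simple h'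
  exact (hY hne).false ((asIso (x t)).symm ≪≫ asIso (x t'))

/-- A nonzero morphism from a simple object to a sum of pairwise non-isomorphic simple objects is an
isomorphism onto one of the summands. -/
lemma exists_eq_single {U : C} [Simple U] {Y : DirectSumCompletion.{w} C}
    (hs : ∀ t, Simple (Y.obj t)) (hY : ∀ t t', t ≠ t' → IsEmpty (Y.obj t ≅ Y.obj t'))
    {x : Col U Y} (hx : x ≠ 0) : ∃ (t : Y.ι) (φ : U ⟶ Y.obj t), IsIso φ ∧ x = single t φ := by
  obtain ⟨t, ht⟩ : ∃ t, x t ≠ 0 := by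
    by_contra! h
    exact hx (DFinsupp.ext h)
  refine ⟨t, x t, isIso_of_hom_simple ht, eq_single_of_forall_ne x t fun t' hne => ?_⟩
  by_contra h'
  exact hne (eq_of_apply_ne_zero (hY t' t) h' ht)

/-- A nonzero morphism from a simple object to an object that decomposes as a sum of
pairwise non-isomorphic simple objects is an isomorphism onto one of the summands. -/
lemma exists_eq_pre_gen {A : DirectSumCompletion.{w} C} {I : Type w} {J : I → C}
    (θ : A ≅ ⟨I, J⟩) (hs : ∀ i, Simple (J i))
    (hne : ∀ i j, i ≠ j → IsEmpty (J i ≅ J j)) {U : C} [Simple U] {x : Col U A} (hx : x ≠ 0) :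
    ∃ (i : I) (φ : U ⟶ J i), IsIso φ ∧ x = pre φ (gen θ i) := by
  have hx' : post θ.inv (post θ.hom x) = x := by rw [← post_comp, θ.hom_inv_id, post_id]
  have hx0 : post θ.hom x ≠ 0 := fun h => hx (by rw [← hx', h, map_zero])
  obtain ⟨i, φ, hφ, h⟩ := exists_eq_single (Y := ⟨I, J⟩) hs hne hx0
  refine ⟨i, φ, hφ, ?_⟩
  rw [← hx', h, post_single (Y := ⟨I, J⟩)]

lemma pre_sum {X X' : C} {Y : DirectSumCompletion.{w} C} {κ : Type*} (s : Finset κ)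
    (φ : κ → (X ⟶ X')) (x : Col X' Y) : pre (∑ k ∈ s, φ k) x = ∑ k ∈ s, pre (φ k) x := by
  rw [map_sum, AddMonoidHom.finsetSum_apply]

/-- To be an isomorphism can be tested on columns from simple objects. -/
lemma isIso_of_bijective_of_simple (hC : IsSemisimpleAbelian C) {X Y : DirectSumCompletion.{w} C}
    (f : X ⟶ Y) (inj : ∀ N : C, Simple N → ∀ x : Col N X, post f x = 0 → x = 0)
    (surj : ∀ N : C, ∀ y : Col N Y, ∃ x : Col N X, post f x = y) : IsIso f := by
  refine isIso_of_bijective f (fun N x hx => ?_) surj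
  obtain ⟨n, S, i, p, hS, -, h⟩ := hC.exists_retracts N
  rw [← pre_id x, ← h, pre_sum]
  refine Finset.sum_eq_zero fun k _ => ?_
  rw [← pre_pre, inj (S k) (hS k) (pre (i k) x) (by rw [post_pre, hx, map_zero]), map_zero]

end DirectSumCompletion

/-! ### Retracts inside simple modules -/

section Modules

variable {D : Type u} [Category.{v} D] [MonoidalCategory D] {A : D} [MonObj A]

/-- A retract `Y` of an `A`-module `X` such that `A ⊗ Y ⟶ X` lands in `Y` is an `A`-module. -/
abbrev modObjOfRetract (X : Mod D A) {Y : D} (i : Y ⟶ X.X) (p : X.X ⟶ Y) (hip : i ≫ p = 𝟙 Y)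
    (h : A ◁ i ≫ ModObj.smul (M := A) (X := X.X) ≫ p ≫ i =
      A ◁ i ≫ ModObj.smul (M := A) (X := X.X)) : ModObj A Y where
  smul := (A ◁ i ≫ ModObj.smul (M := A) (X := X.X) ≫ p : A ⊗ Y ⟶ Y)
  one_smul := by
    change MonObj.one ▷ Y ≫ A ◁ i ≫ ModObj.smul (M := A) (X := X.X) ≫ p = (λ_ Y).hom
    rw [← whisker_exchange_assoc, ModObj.one_smul_self_assoc, leftUnitor_naturality_assoc, hip,
      Category.comp_id]
  mul_smul := by
    change MonObj.mul ▷ Y ≫ A ◁ i ≫ ModObj.smul (M := A) (X := X.X) ≫ p =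
      (α_ A A Y).hom ≫ A ◁ (A ◁ i ≫ ModObj.smul (M := A) (X := X.X) ≫ p) ≫
        A ◁ i ≫ ModObj.smul (M := A) (X := X.X) ≫ p
    rw [← MonoidalCategory.whiskerLeft_comp_assoc, Category.assoc, Category.assoc, h,
      ← whisker_exchange_assoc, ModObj.mul_smul_self_assoc]
    simp

lemma mono_of_mono_mod_hom {X Y : Mod D A} (f : X ⟶ Y) [Mono f.hom] : Mono f where
  right_cancellation g h w := by
    apply Mod.hom_ext
    rw [← cancel_mono f.hom]
    exact congrArg Mod.Hom.hom w

/-- The retraction `p` need not be `A`-linear, but it makes `f` a monomorphism. Simplicity leaves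
only zero or an isomorphism, and in the second case the one-sided inverse `p` is two-sided. -/
lemma eq_zero_or_comp_eq_id_of_hom [Preadditive D] [MonoidalPreadditive D] {X Y : Mod D A}
    [Simple X] (f : Y ⟶ X) (p : X.X ⟶ Y.X) (hfp : f.hom ≫ p = 𝟙 Y.X) :
    f.hom = 0 ∨ p ≫ f.hom = 𝟙 X.X := by
  have : Mono f.hom := mono_of_mono_fac hfp
  have := mono_of_mono_mod_hom f
  by_cases hf : f = 0
  · exact Or.inl (congrArg Mod.Hom.hom hf)
  · right
    have := isIso_of_mono_of_nonzero hf
    have hi : (inv f).hom ≫ f.hom = 𝟙 X.X := congrArg Mod.Hom.hom (IsIso.inv_hom_id f)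
    calc p ≫ f.hom = ((inv f).hom ≫ f.hom) ≫ p ≫ f.hom := by rw [hi, Category.id_comp]
      _ = (inv f).hom ≫ (f.hom ≫ p) ≫ f.hom := by simp only [Category.assoc]
      _ = 𝟙 X.X := by rw [hfp, Category.id_comp, hi]

/-- A retract of a simple module that is stable under the action is zero or everything. -/
lemma eq_zero_or_comp_eq_id_of_retract [Preadditive D] [MonoidalPreadditive D] (X : Mod D A)
    [Simple X] {Y : D} (i : Y ⟶ X.X) (p : X.X ⟶ Y)
    (hip : i ≫ p = 𝟙 Y) (h : A ◁ i ≫ ModObj.smul (M := A) (X := X.X) ≫ p ≫ i =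
      A ◁ i ≫ ModObj.smul (M := A) (X := X.X)) : i = 0 ∨ p ≫ i = 𝟙 X.X := by
  let := modObjOfRetract X i p hip h
  refine eq_zero_or_comp_eq_id_of_hom (Y := ⟨Y⟩) (Mod.Hom.mk' (M := ⟨Y⟩) i ?_) p hip
  change (A ◁ i ≫ ModObj.smul (M := A) (X := X.X) ≫ p) ≫ i =
    A ◁ i ≫ ModObj.smul (M := A) (X := X.X)
  rw [Category.assoc, Category.assoc, h]

/-- If `A` is simple as a module over itself, then tensoring with `A` annihilates a retract of the
tensor unit or does not distinguish it from the tensor unit. -/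
lemma whiskerLeft_retract_unit [Preadditive D] [MonoidalPreadditive D] [Simple (Mod.regular A)]
    {S : D} (s : S ⟶ 𝟙_ D) (p : 𝟙_ D ⟶ S) (h : s ≫ p = 𝟙 S) :
    A ◁ s = 0 ∨ A ◁ (p ≫ s) = 𝟙 (A ⊗ 𝟙_ D) := by
  -- The `A`-linear map extending `S ⟶ 𝟙 ⟶ A` is `A ◁ s` up to the right unitor, so it inherits a
  -- retraction from `p`.
  let f := inducedDesc (Mod.regular A) (s ≫ MonObj.one : S ⟶ A)
  have hf : (f.hom : A ⊗ S ⟶ A) = A ◁ s ≫ (ρ_ A).hom := by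
    change A ◁ (s ≫ MonObj.one : S ⟶ A) ≫ MonObj.mul = _
    rw [MonoidalCategory.whiskerLeft_comp, Category.assoc, MonObj.mul_one]
  have hfp : (A ◁ s ≫ (ρ_ A).hom) ≫ (ρ_ A).inv ≫ A ◁ p = 𝟙 (A ⊗ S) := by
    rw [Category.assoc, Iso.hom_inv_id_assoc, ← MonoidalCategory.whiskerLeft_comp, h,
      whiskerLeft_id]
  rcases eq_zero_or_comp_eq_id_of_hom f ((ρ_ A).inv ≫ A ◁ p)
    ((congrArg (fun g : A ⊗ S ⟶ A => g ≫ (ρ_ A).inv ≫ A ◁ p) hf).trans hfp) with h0 | h1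
  · left
    have h0' : A ◁ s ≫ (ρ_ A).hom = 0 := hf.symm.trans h0
    rw [← cancel_mono (ρ_ A).hom, h0', zero_comp]
  · right
    have h1' : ((ρ_ A).inv ≫ A ◁ p) ≫ A ◁ s ≫ (ρ_ A).hom = 𝟙 A :=
      (congrArg (fun g : A ⊗ S ⟶ A => ((ρ_ A).inv ≫ A ◁ p) ≫ g) hf.symm).trans h1
    rw [← cancel_mono (ρ_ A).hom, ← cancel_epi (ρ_ A).inv]
    simpa using h1'

end Modules

/-! ### Simplicity of the tensor unit -/

namespace DirectSumCompletion

section Preadditive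

variable {C : Type u} [Category.{v} C] [Preadditive C]

/-- The morphism of one-term direct sums given by a morphism of `C`. -/
def ofMap {X Y : C} (f : X ⟶ Y) : (of X : DirectSumCompletion.{w} C) ⟶ of Y :=
  monomial (X := of X) (Y := of Y) (fun _ => PUnit.unit) (fun _ => f)

lemma ofMap_comp {X Y Z : C} (f : X ⟶ Y) (g : Y ⟶ Z) :
    (ofMap (f ≫ g) : (of X : DirectSumCompletion.{w} C) ⟶ of Z) = ofMap f ≫ ofMap g :=
  hom_ext fun _ => by
    rw [comp_col]
    exact (pre_single (Y := of Z) f PUnit.unit g).symm.trans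
      (post_single (Y := of Y) (ofMap g) PUnit.unit f).symm

lemma ofMap_id (X : C) : ofMap (𝟙 X) = 𝟙 (of X : DirectSumCompletion.{w} C) := rfl

lemma ofMap_zero (X Y : C) : (ofMap (0 : X ⟶ Y) : (of X : DirectSumCompletion.{w} C) ⟶ of Y) = 0 :=
  hom_ext fun _ => map_zero _

end Preadditive

section Monoidal

variable {C : Type u} [Category.{v} C] [Preadditive C] [MonoidalCategory C] [MonoidalPreadditive C]

/-- On the single summand `J i` of `A` the two sides restrict to `J i ◁ f` and `J i ◁ g`, and
tensoring with an invertible object is faithful. -/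
lemma whiskerLeft_ofMap_injective [BraidedCategory C] {A : DirectSumCompletion.{w} C} {I : Type w}
    {J : I → C} (θ : A ≅ ⟨I, J⟩) (i : I) (hJ : IsSimpleCurrent (J i)) {X Y : C} {f g : X ⟶ Y}
    (h : A ◁ (ofMap f : (of X : DirectSumCompletion.{w} C) ⟶ of Y) = A ◁ ofMap g) : f = g := by
  have key : ∀ f : X ⟶ Y, post (tensorMap θ.hom (𝟙 (of Y)))
      (post (tensorMap (𝟙 A) (ofMap f)) (tensorCol (gen θ i) (single (Y := of X) PUnit.unit (𝟙 X))))
        = single (Y := tensor ⟨I, J⟩ (of Y)) (i, PUnit.unit) (J i ◁ f) := by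
    intro f
    rw [post_tensorCol, post_tensorCol, post_id, post_id, post_gen, post_single, ofMap,
      monomial_col, pre_id, tensorCol_single, id_tensorHom]
  have h2 := (key f).symm.trans (Eq.trans (by
    rw [show tensorMap (𝟙 A) (ofMap f) = tensorMap (𝟙 A) (ofMap g) from h]) (key g))
  apply hJ.whiskerLeft_injective
  have h3 := congrArg (fun x => x (i, PUnit.unit)) h2
  rwa [single_apply_self, single_apply_self] at h3

variable {A : DirectSumCompletion.{w} C} [MonObj A]

/-- If the unit vanished, then so would every `a = 1 · a`, and `A` would be a zero module. -/
lemma oneCol_ne_zero [Simple (Mod.regular A)] : oneCol A ≠ 0 := by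
  intro h
  refine id_nonzero (Mod.regular A) (Mod.hom_ext _ _ (hom_ext (X := A) (Y := A) fun s => ?_))
  have h2 := pre_leftUnitor_inv_mulCol (Hom.col (𝟙 A) s)
  rw [h, map_zero, AddMonoidHom.zero_apply, map_zero] at h2
  exact h2.symm

end Monoidal

section Abelian

variable {C : Type u} [Category.{v} C] [Abelian C] [MonoidalCategory C] [MonoidalPreadditive C]
  {A : DirectSumCompletion.{w} C} [MonObj A] {I : Type w} {J : I → C}

lemma nonempty_of_simple [Simple (Mod.regular A)] (θ : A ≅ ⟨I, J⟩) : Nonempty I := by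
  by_contra! hI
  refine oneCol_ne_zero (A := A) ?_
  induction oneCol A using col_induction_of_iso θ with
  | zero => rfl
  | gen i f => exact (hI.false i).elim
  | add a b ha hb => rw [ha, hb, add_zero]

/-- If an algebra that is simple as a module over itself is a sum of simple currents, then the
tensor unit is simple. -/
lemma simple_unit [BraidedCategory C] (hC : IsSemisimpleAbelian C) [Simple (Mod.regular A)]
    (θ : A ≅ ⟨I, J⟩) (hJ : ∀ i, IsSimpleCurrent (J i)) : Simple (𝟙_ C) := by
  obtain ⟨i⟩ := nonempty_of_simple θ
  obtain ⟨n, S, s, p, hS, hsp, hps⟩ := hC.exists_retracts (𝟙_ C)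
  obtain ⟨k⟩ : Nonempty (Fin n) := by
    by_contra! hn
    refine oneCol_ne_zero (A := A) ?_
    rw [← pre_id (oneCol A), ← hps, Finset.univ_eq_empty, Finset.sum_empty, map_zero,
      AddMonoidHom.zero_apply]
  have := hS k
  -- For a simple summand `S k` of the unit, `A ⊗ S k` is zero or everything. Faithfulness of `A ◁
  -- -` transfers this to `C`: either `S k` is zero, which is absurd, or `S k` is isomorphic to the
  -- unit.
  rcases whiskerLeft_retract_unit (A := A) (S := of (S k)) (ofMap (s k)) (ofMap (p k))
    (by rw [← ofMap_id, ← hsp]; exact (ofMap_comp _ _).symm) with h | h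
  · have hs : s k = 0 := whiskerLeft_ofMap_injective θ i (hJ i) (h.trans (by
      rw [ofMap_zero]
      exact (MonoidalPreadditive.whiskerLeft_zero).symm))
    refine (id_nonzero (S k) ?_).elim
    rw [← hsp, hs, zero_comp]
  · have h2 : A ◁ ofMap (p k ≫ s k) = A ◁ ofMap (𝟙 (𝟙_ C)) := by
      rw [ofMap_comp, ofMap_id, whiskerLeft_id]
      exact h
    exact Simple.of_iso ⟨p k, s k, whiskerLeft_ofMap_injective θ i (hJ i) h2, hsp k⟩

end Abelian

end DirectSumCompletion

/-! ### Invertibility of the summands inside the algebra -/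

namespace DirectSumCompletion

variable {C : Type u} [Category.{v} C] [Abelian C] [MonoidalCategory C] [MonoidalPreadditive C]
  {A : DirectSumCompletion.{w} C} {I : Type w} {J : I → C}

lemma gen_ne_zero {C : Type u} [Category.{v} C] [Preadditive C] {A : DirectSumCompletion.{w} C}
    {I : Type w} {J : I → C} (θ : A ≅ ⟨I, J⟩) (i : I) [Simple (J i)] : gen θ i ≠ 0 := by
  intro h
  have h2 := post_gen θ i
  rw [h, map_zero] at h2
  refine id_nonzero (J i) ?_
  rw [← single_apply_self (Y := ⟨I, J⟩) i (𝟙 (J i)), ← h2]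
  rfl

open Classical in
/-- The projection of a direct sum onto the sum over a subset of the index set. -/
def subsetProj (J : I → C) (K : Set I) :
    (⟨I, J⟩ : DirectSumCompletion.{w} C) ⟶ ⟨K, fun k => J k⟩ :=
  Hom.mk (X := ⟨I, J⟩) fun k => if h : k ∈ K then
    single (X := J k) (Y := ⟨K, fun k => J k⟩) ⟨k, h⟩ (𝟙 (J k)) else 0

variable [MonObj A]

/-- A nonempty set of summands of `A` that is stable under the action of `A` contains every
summand, if `A` is simple as a module over itself. -/
lemma mem_of_mulCol_stable [Simple (Mod.regular A)] (θ : A ≅ ⟨I, J⟩) (hs : ∀ i, Simple (J i))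
    {K : Set I} {j : I} (hj : j ∈ K)
    (hK : ∀ q : A ⟶ A, (∀ k ∈ K, post q (gen θ k) = gen θ k) →
      ∀ (U : C) (a : Col U A), ∀ k ∈ K, post q (mulCol a (gen θ k)) = mulCol a (gen θ k))
    (k : I) : k ∈ K := by
  let Y : DirectSumCompletion.{w} C := ⟨K, fun k => J k⟩
  let i : Y ⟶ A := Hom.mk (X := Y) fun k => gen θ k
  let p : A ⟶ Y := θ.hom ≫ subsetProj J K
  have hp : ∀ k (hk : k ∈ K), post p (gen θ k) = single (X := J k) (Y := Y) ⟨k, hk⟩ (𝟙 (J k)) := by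
    intro k hk
    rw [post_comp, post_gen, post_single (Y := ⟨I, J⟩), pre_id]
    exact dif_pos hk
  have hp' : ∀ k, k ∉ K → post p (gen θ k) = 0 := by
    intro k hk
    rw [post_comp, post_gen, post_single (Y := ⟨I, J⟩), pre_id]
    exact dif_neg hk
  have hip : i ≫ p = 𝟙 Y := hom_ext fun k => hp k.1 k.2
  have hq : ∀ k ∈ K, post (p ≫ i) (gen θ k) = gen θ k := by
    intro k hk
    rw [post_comp, hp k hk, post_single (Y := Y) i ⟨k, hk⟩]
    exact pre_id _
  -- The idempotent `p ≫ i` fixes the summands in `K`, so `hK` applies to it and says that `A · Y`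
  -- stays in `Y`; thus `Y` is a submodule.
  have hst : A ◁ i ≫ MonObj.mul ≫ p ≫ i = A ◁ i ≫ MonObj.mul := by
    refine hom_ext (X := tensor A Y) fun s => ?_
    refine Eq.trans ?_ (hK (p ≫ i) hq _ (single s.1 (𝟙 (A.obj s.1))) s.2.1 s.2.2)
    exact post_comp (Y := tensor A A) MonObj.mul (p ≫ i) _
  rcases eq_zero_or_comp_eq_id_of_retract (Mod.regular A) i p hip hst with h | h
  · have := hs j
    exact (gen_ne_zero θ j (congrArg (fun f : Y ⟶ A => Hom.col f ⟨j, hj⟩) h)).elim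
  · by_contra hk
    have := hs k
    refine gen_ne_zero θ k ?_
    have h' : p ≫ i = 𝟙 A := h
    rw [← post_id (gen θ k), ← h', post_comp, hp' k hk, map_zero]

/-- The summands of a simple current extension are invertible with respect to its product. -/
lemma exists_mulCol_eq_oneCol [BraidedCategory C] [Simple (Mod.regular A)] [Simple (𝟙_ C)]
    (θ : A ≅ ⟨I, J⟩) (hJ : ∀ i, IsSimpleCurrent (J i)) (hne : ∀ i j, i ≠ j → IsEmpty (J i ≅ J j))
    (j : I) : ∃ (l : I) (ψ : 𝟙_ C ⟶ J l ⊗ J j), pre ψ (mulCol (gen θ l) (gen θ j)) = oneCol A := by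
  have hs : ∀ i, Simple (J i) := fun i => (hJ i).simple
  -- The source `𝟙_ C` of the unit is simple, so the unit lands in a single summand `J i₀`.
  obtain ⟨i₀, u, hu, h1⟩ := exists_eq_pre_gen θ hs hne (oneCol_ne_zero (A := A))
  -- The summands contained in the left ideal `A · J j`. The goal is `i₀ ∈ K`, since then the unit
  -- lies in some `J l · J j`.
  let K : Set I := {k | ∃ (l : I) (φ : J k ⟶ J l ⊗ J j),
    pre φ (mulCol (gen θ l) (gen θ j)) = gen θ k}
  have hj : j ∈ K := by
    refine ⟨i₀, (λ_ (J j)).inv ≫ u ▷ J j, ?_⟩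
    conv_rhs => rw [← pre_leftUnitor_inv_mulCol (gen θ j), h1, ← pre_id (gen θ j), pre_mulCol,
      pre_pre, tensorHom_id]
  have hK : ∀ q : A ⟶ A, (∀ k ∈ K, post q (gen θ k) = gen θ k) →
      ∀ (U : C) (a : Col U A), ∀ k ∈ K, post q (mulCol a (gen θ k)) = mulCol a (gen θ k) := by
    intro q hq
    -- Each product `J m · J j` is zero or, by Schur's lemma, one of the summands of `A`; that
    -- summand is in `K` by construction and so is fixed by `q`.
    have hqj : ∀ (V : C) (b : Col V A),
        post q (mulCol b (gen θ j)) = mulCol b (gen θ j) := by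
      intro V b
      induction b using col_induction_of_iso θ with
      | zero => simp
      | add a b ha hb => rw [map_add, AddMonoidHom.add_apply, map_add, ha, hb]
      | gen m f =>
        rw [← pre_id (gen θ j), pre_mulCol, post_pre]
        congr 1
        have := hs j
        have := (hJ m).simple_tensor (J j)
        by_cases h0 : mulCol (gen θ m) (gen θ j) = 0
        · rw [h0, map_zero]
        obtain ⟨k, χ, hχ, h⟩ := exists_eq_pre_gen θ hs hne h0
        rw [h, post_pre, hq k ⟨m, inv χ, by rw [h, pre_pre, IsIso.inv_hom_id, pre_id]⟩]
    rintro U a k ⟨l, φ, hφ⟩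
    -- As `J k` comes from `J l · J j`, associativity rewrites `a · J k` through `(a · J l) · J j`,
    -- which `hqj` covers.
    have hassoc := mulCol_assoc a (gen θ l) (gen θ j)
    have h : mulCol a (gen θ k) = pre (𝟙 U ⊗ₘ φ) (pre (α_ U (J l) (J j)).inv
        (mulCol (mulCol a (gen θ l)) (gen θ j))) := by
      rw [hassoc, pre_pre (α_ U (J l) (J j)).inv, Iso.inv_hom_id, pre_id, ← pre_mulCol, hφ, pre_id]
    rw [h, post_pre, post_pre, hqj]
  obtain ⟨l, φ, hφ⟩ := mem_of_mulCol_stable θ hs hj hK i₀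
  exact ⟨l, u ≫ φ, by rw [← pre_pre, hφ, h1]⟩

end DirectSumCompletion

/-! ### Inverting the action; maps between modules induced from simple objects -/

namespace DirectSumCompletion

section Support

variable {C : Type u} [Category.{v} C] [Preadditive C]

/-- Induction over the nonzero entries of a column. -/
lemma col_support_induction {N : C} {Y : DirectSumCompletion.{w} C} {p : Col N Y → Prop}
    (z : Col N Y) (zero : p 0) (of : ∀ t, z t ≠ 0 → p (single t (z t)))
    (add : ∀ a b, p a → p b → p (a + b)) : p z := by
  classical
  rw [← DirectSum.sum_support_of z]
  refine Finset.sum_induction _ p add zero fun t ht => ?_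
  have h := of t (DFinsupp.mem_support_iff.1 ht)
  rw [single, Subsingleton.elim (Classical.decEq Y.ι) (fun a b => Classical.propDecidable _)] at h
  exact h

end Support

variable {C : Type u} [Category.{v} C] [Abelian C] [MonoidalCategory C] [MonoidalPreadditive C]
  {A : DirectSumCompletion.{w} C} [MonObj A] {I : Type w} {J : I → C}

/-- Acting with a summand `J i` can be undone if the summand is invertible in `A`. -/
lemma exists_pre_act_act (θ : A ≅ ⟨I, J⟩) {i l : I} {ψ : 𝟙_ C ⟶ J l ⊗ J i}
    (hψ : pre ψ (mulCol (gen θ l) (gen θ i)) = oneCol A)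
    (X : Mod (DirectSumCompletion.{w} C) A) {V : C} (x : Col V X.X) :
    ∃ χ : V ⟶ J l ⊗ (J i ⊗ V), pre χ (act X (gen θ l) (act X (gen θ i) x)) = x := by
  -- The witness inserts the unit before `V` and expands it by `ψ`: after reassociation, `J l · (J i
  -- · x)` becomes `1 · x`.
  refine ⟨(λ_ V).inv ≫ (ψ ⊗ₘ 𝟙 V) ≫ (α_ (J l) (J i) V).hom, ?_⟩
  rw [← pre_pre, ← pre_pre, ← act_mulCol, ← pre_act, hψ, pre_id, pre_leftUnitor_inv_act]

/-- A nonzero morphism between modules induced from simple objects is a split epimorphism. -/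
lemma isSplitEpi_of_ne_zero (θ : A ≅ ⟨I, J⟩)
    (hs : ∀ i (M : C), Simple M → Simple (J i ⊗ M))
    (hM : ∀ i j (M : C), Simple M → i ≠ j → IsEmpty (J i ⊗ M ≅ J j ⊗ M))
    (hinv : ∀ i, ∃ (l : I) (ψ : 𝟙_ C ⟶ J l ⊗ J i),
      pre ψ (mulCol (gen θ l) (gen θ i)) = oneCol A) {M N : C} [Simple M] [Simple N]
    (h : inducedModule A (of M) ⟶ inducedModule A (of N)) (h0 : h ≠ 0) : IsSplitEpi h := by
  let m := Hom.col (inducedUnit A (of M)) PUnit.unit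
  let n := Hom.col (inducedUnit A (of N)) PUnit.unit
  have hx : post h.hom m ≠ 0 := by
    intro hx
    refine h0 (induced_hom_ext (hom_ext fun _ => ?_))
    have h1 : inducedUnit A (of M) ≫ (0 : inducedModule A (of M) ⟶ inducedModule A (of N)).hom = 0 :=
      comp_zero
    exact hx.trans (congrArg (fun f => Hom.col f PUnit.unit) h1).symm
  -- The image of the generator `m` is nonzero with simple source, so it is an isomorphism onto one
  -- summand, that is, `J i · n` up to `φ`.
  obtain ⟨⟨i, _⟩, φ, hφ, hx⟩ := exists_eq_pre_gen (A := (inducedModule A (of N)).X)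
    (I := I × PUnit) (J := fun p => J p.1 ⊗ N) (whiskerRightIso θ (of N))
    (fun p => hs p.1 N inferInstance)
    (fun p q hpq => hM _ _ N inferInstance fun h => hpq (Prod.ext h rfl)) hx
  have hg : gen (A := (inducedModule A (of N)).X) (I := I × PUnit) (J := fun p => J p.1 ⊗ N)
      (whiskerRightIso θ (of N)) (i, PUnit.unit) = act (inducedModule A (of N)) (gen θ i) n := by
    have h1 : n = post (inducedUnit A (of N)) (single (Y := of N) PUnit.unit (𝟙 N)) := by
      rw [post_single (Y := of N), pre_id]
    rw [h1]
    exact (act_inducedUnit (gen θ i) _).symm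
  obtain ⟨l, ψ, hψ⟩ := hinv i
  obtain ⟨χ, hχ⟩ := exists_pre_act_act θ hψ (inducedModule A (of N)) n
  have hn : pre (χ ≫ J l ◁ inv φ) (act (inducedModule A (of N)) (gen θ l) (post h.hom m)) = n := by
    rw [hx, ← pre_pre, ← id_tensorHom, ← pre_act, pre_id, pre_pre, IsIso.inv_hom_id, pre_id]
    exact (congrArg _ (congrArg _ hg)).trans hχ
  -- Since `n` is recovered as `J l · h(m)`, the section sends `n` to the same expression in `m`.
  let k : inducedModule A (of N) ⟶ inducedModule A (of M) := inducedDesc (inducedModule A (of M))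
    (ofCol (pre (χ ≫ J l ◁ inv φ) (act (inducedModule A (of M)) (gen θ l) m)))
  refine ⟨⟨⟨k, induced_hom_ext ?_⟩⟩⟩
  rw [Mod.comp_hom', ← Category.assoc, inducedUnit_inducedDesc, Mod.id_hom', Category.comp_id]
  refine hom_ext fun _ => ?_
  refine Eq.trans ?_ hn
  rw [← post_act, ← post_pre]
  rfl

end DirectSumCompletion

/-! ### Maximal independent families and induced modules -/

namespace DirectSumCompletion

variable {C : Type u} [Category.{v} C] [Abelian C] [MonoidalCategory C] [MonoidalPreadditive C]
  {A : DirectSumCompletion.{w} C} [MonObj A] {I : Type w} {J : I → C}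

/-- The morphism `⨁ J i ⊗ M e ⟶ X` given by a family of elements of an `A`-module `X`. -/
def familyMap (θ : A ≅ ⟨I, J⟩) (X : Mod (DirectSumCompletion.{w} C) A) {E : Type w} {M : E → C}
    (x : ∀ e, Col (M e) X.X) : tensor ⟨I, J⟩ ⟨E, M⟩ ⟶ X.X :=
  Hom.mk (X := tensor ⟨I, J⟩ ⟨E, M⟩) fun p => act X (gen θ p.1) (x p.2)

/-- A set of elements of an `A`-module is independent if the submodules that they generate are
induced and form a direct sum. -/
def IsIndependent (θ : A ≅ ⟨I, J⟩) (X : Mod (DirectSumCompletion.{w} C) A) {E : Type w} {M : E → C}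
    (x : ∀ e, Col (M e) X.X) (T : Set E) : Prop :=
  ∀ N : C, Simple N → ∀ z : Col N (tensor ⟨I, J⟩ ⟨E, M⟩), (∀ p, p.2 ∉ T → z p = 0) →
    post (familyMap θ X x) z = 0 → z = 0

/-- Zorn's lemma applies because independence has finite character: a relation is a column, which
has finitely many nonzero entries, so over the union of a nonempty chain it already lives in one
member. -/
lemma exists_maximal_isIndependent (θ : A ≅ ⟨I, J⟩) (X : Mod (DirectSumCompletion.{w} C) A)
    {E : Type w} {M : E → C} (x : ∀ e, Col (M e) X.X) :
    ∃ T, Maximal (IsIndependent θ X x) T := by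
  refine zorn_subset {T | IsIndependent θ X x T} fun c hc hchain => ?_
  refine ⟨⋃₀ c, fun N hN z hz hz0 => ?_, fun s hs => Set.subset_sUnion_of_mem hs⟩
  rcases c.eq_empty_or_nonempty with rfl | hne
  · exact DFinsupp.ext fun p => hz p (by simp)
  · have hfin : (Prod.snd '' {p | z p ≠ 0}).Finite := (DFinsupp.finite_support z).image _
    obtain ⟨T, hT, hsub⟩ := hchain.directedOn.exists_mem_subset_of_finite_of_subset_sUnion hne hfin
      (by
        rintro _ ⟨p, hp, rfl⟩
        by_contra h
        exact hp (hz p h))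
    refine hc hT N hN z (fun p hp => ?_) hz0
    by_contra h
    exact hp (hsub ⟨p, h, rfl⟩)

/-- The morphism `⨁ M t ⟶ X` given by the members of a family of elements of `X` in a set `T`. -/
def subfamilyHom {X : DirectSumCompletion.{w} C} {E : Type w} {M : E → C} (x : ∀ e, Col (M e) X)
    (T : Set E) : (⟨T, fun t => M t⟩ : DirectSumCompletion.{w} C) ⟶ X :=
  Hom.mk (X := ⟨T, fun t => M t⟩) fun t => x t

/-- The elements of a maximal independent set generate all the others. -/
lemma exists_post_inducedDesc_eq (θ : A ≅ ⟨I, J⟩)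
    (hinv : ∀ i, ∃ (l : I) (ψ : 𝟙_ C ⟶ J l ⊗ J i),
      pre ψ (mulCol (gen θ l) (gen θ i)) = oneCol A)
    (X : Mod (DirectSumCompletion.{w} C) A) {E : Type w} {M : E → C} (x : ∀ e, Col (M e) X.X)
    (hs : ∀ i e, Simple (J i ⊗ M e))
    (hM : ∀ i j e, i ≠ j → IsEmpty (J i ⊗ M e ≅ J j ⊗ M e)) {T : Set E}
    (hT : Maximal (IsIndependent θ X x) T) (e : E) :
    ∃ z, post (inducedDesc X (subfamilyHom x T)).hom z = x e := by
  -- `R N y` says that `y` lies in the submodule generated by `T`.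
  set R : ∀ N : C, Col N X.X → Prop :=
    fun N y => ∃ z, post (inducedDesc X (subfamilyHom x T)).hom z = y with hR
  have hpre : ∀ {N N' : C} (f : N' ⟶ N) (y : Col N X.X), R N y → R N' (pre f y) := by
    rintro N N' f _ ⟨z, rfl⟩
    exact ⟨pre f z, post_pre _ _ _⟩
  have hact : ∀ {U N : C} (a : Col U A) (y : Col N X.X), R N y → R (U ⊗ N) (act X a y) := by
    rintro U N a _ ⟨z, rfl⟩
    exact ⟨act (inducedModule A _) a z, post_act _ _ _⟩
  have hmem : ∀ e ∈ T, R (M e) (x e) := by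
    intro e he
    refine ⟨Hom.col (inducedUnit A ⟨T, fun t => M t⟩) ⟨e, he⟩, ?_⟩
    exact congrArg (fun f => Hom.col f (⟨e, he⟩ : T)) (inducedUnit_inducedDesc X (subfamilyHom x T))
  have hsupp : ∀ (N : C) (z : Col N (tensor ⟨I, J⟩ ⟨E, M⟩)), (∀ p, p.2 ∉ T → z p = 0) →
      R N (post (familyMap θ X x) z) := by
    intro N z hz
    refine col_support_induction (p := fun z => R N (post (familyMap θ X x) z)) z ?_ ?_ ?_
    · exact ⟨0, by rw [map_zero, map_zero]⟩
    · intro p hp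
      rw [post_single (Y := tensor ⟨I, J⟩ ⟨E, M⟩)]
      refine hpre _ _ (hact _ _ (hmem _ ?_))
      by_contra h
      exact hp (hz p h)
    · rintro a b ⟨y, hy⟩ ⟨y', hy'⟩
      exact ⟨y + y', by rw [map_add, map_add, hy, hy']⟩
  by_cases he : e ∈ T
  · exact hmem e he
  have hnot : ¬ IsIndependent θ X x (insert e T) := fun h =>
    he (hT.le_of_ge h (Set.subset_insert e T) (Set.mem_insert e T))
  simp only [IsIndependent, not_forall] at hnot
  obtain ⟨N, hN, z, hz, hz0, hzne⟩ := hnot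
  -- A relation without `e`-part would be a relation over `T`.
  obtain ⟨i, hi⟩ : ∃ i, z (i, e) ≠ 0 := by
    by_contra! h
    refine hzne (hT.prop N hN z (fun p hp => ?_) hz0)
    by_cases hpe : p.2 = e
    · subst hpe
      exact h p.1
    · exact hz p fun h => h.elim hpe hp
  have := hs i e
  have hφ : IsIso (z (i, e)) := isIso_of_hom_simple hi
  -- Fixed-point freeness enters here: a second nonzero entry at `(j, e)` would give `J j ⊗ M e ≅ J
  -- i ⊗ M e`. So removing the one entry `(i, e)` leaves a combination of members of `T`.
  have hz' : R N (post (familyMap θ X x) (z - single (Y := tensor ⟨I, J⟩ ⟨E, M⟩) (i, e)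
      (z (i, e)))) := by
    refine hsupp N _ fun p hp => ?_
    refine (DirectSum.sub_apply _ _ p).trans ?_
    by_cases hpe : p = (i, e)
    · subst hpe
      rw [single_apply_self, sub_self]
    · rw [single_apply_of_ne hpe, sub_zero]
      obtain ⟨j, e'⟩ := p
      by_cases hee : e' = e
      · subst hee
        by_contra hj
        have := hs j e'
        exact hpe (eq_of_apply_ne_zero (Y := tensor ⟨I, J⟩ ⟨E, M⟩)
          (fun hne => hM j i e' fun h => hne (by rw [h])) hj hi)
      · exact hz _ fun h => h.elim hee hp
  rw [map_sub, hz0, zero_sub, post_single (Y := tensor ⟨I, J⟩ ⟨E, M⟩)] at hz'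
  obtain ⟨y, hy⟩ := hz'
  -- The relation, solved for the removed entry and composed with the inverse of `z (i, e)`, places
  -- `J i · x e` in the submodule; acting with `J l` then recovers `x e`.
  have hRe : R (J i ⊗ M e) (act X (gen θ i) (x e)) := by
    have h : R N (pre (z (i, e)) (act X (gen θ i) (x e))) := ⟨-y, by rw [map_neg, hy, neg_neg]; rfl⟩
    have h2 := hpre (inv (z (i, e))) _ h
    rwa [pre_pre, IsIso.inv_hom_id, pre_id] at h2
  obtain ⟨l, ψ, hψ⟩ := hinv i
  obtain ⟨χ, hχ⟩ := exists_pre_act_act θ hψ X (x e)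
  rw [← hχ]
  exact hpre _ _ (hact _ _ hRe)

/-- Every `A`-module is induced from a sum of simple objects, if the summands `J i` of `A` are
invertible in `A` and the objects `J i ⊗ M` are simple and pairwise non-isomorphic for simple `M`. -/
lemma exists_isIso_inducedDesc (hC : IsSemisimpleAbelian C) (θ : A ≅ ⟨I, J⟩)
    (hinv : ∀ i, ∃ (l : I) (ψ : 𝟙_ C ⟶ J l ⊗ J i),
      pre ψ (mulCol (gen θ l) (gen θ i)) = oneCol A)
    (hs : ∀ i (M : C), Simple M → Simple (J i ⊗ M))
    (hM : ∀ i j (M : C), Simple M → i ≠ j → IsEmpty (J i ⊗ M ≅ J j ⊗ M))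
    (X : Mod (DirectSumCompletion.{w} C) A) :
    ∃ (W : DirectSumCompletion.{w} C) (w : W ⟶ X.X), (∀ t, Simple (W.obj t)) ∧
      IsIso (inducedDesc X w).hom := by
  choose n S i p hS _ hps using fun s => hC.exists_retracts (X.X.obj s)
  -- All simple constituents of all summands of `X` are the candidates for generators.
  let E : Type w := Σ s : X.X.ι, Fin (n s)
  let M : E → C := fun e => S e.1 e.2
  let x : ∀ e, Col (M e) X.X := fun e => single e.1 (i e.1 e.2)
  obtain ⟨T, hT⟩ := exists_maximal_isIndependent θ X x
  let W : DirectSumCompletion.{w} C := ⟨T, fun t => M t⟩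
  let Z : DirectSumCompletion.{w} C := tensor ⟨I, J⟩ W
  let ZE : DirectSumCompletion.{w} C := tensor ⟨I, J⟩ ⟨E, M⟩
  have hgen := exists_post_inducedDesc_eq θ hinv X x (fun i e => hs i _ (hS _ _))
    (fun i j e => hM i j _ (hS _ _)) hT
  refine ⟨W, subfamilyHom x T, fun t => hS _ _, ?_⟩
  let incl : Z ⟶ ZE := monomial (X := Z) (Y := ZE) (fun p => (p.1, p.2.1)) (fun p => 𝟙 _)
  have hincl : ∀ (N : C) (z : Col N Z) (q : Z.ι), post incl z (q.1, q.2.1) = z q := by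
    intro N z q
    induction z using col_induction with
    | zero => rw [map_zero]; rfl
    | of t f =>
      rw [post_single, monomial_col]
      refine (congrArg (fun y : Col N ZE => y (q.1, q.2.1))
        (pre_single (Y := ZE) f (t.1, t.2.1) _)).trans ?_
      by_cases hqt : q = t
      · subst hqt
        rw [single_apply_self (Y := ZE) (q.1, q.2.1), single_apply_self]
        exact Category.comp_id f
      · rw [single_apply_of_ne (Y := ZE) (t := (t.1, t.2.1)) (t' := (q.1, q.2.1)) (fun h => hqt
          (Prod.ext (Prod.ext_iff.1 h).1 (Subtype.ext (Prod.ext_iff.1 h).2))),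
          single_apply_of_ne hqt]
    | add a b ha hb => rw [map_add, DirectSum.add_apply, ha, hb, DirectSum.add_apply]
  have hincl' : ∀ (N : C) (z : Col N Z) (q : ZE.ι), q.2 ∉ T → post incl z q = 0 := by
    intro N z q hq
    induction z using col_induction with
    | zero => rw [map_zero]; rfl
    | of t f =>
      rw [post_single, monomial_col]
      refine (congrArg (fun y : Col N ZE => y q) (pre_single (Y := ZE) f (t.1, t.2.1) _)).trans ?_
      refine single_apply_of_ne (Y := ZE) (t := (t.1, t.2.1)) (fun h => hq ?_) _
      rw [h]
      exact t.2.2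
    | add a b ha hb => rw [map_add, DirectSum.add_apply, ha, hb, add_zero]
  -- Under `θ`, the map out of the induced module is `familyMap` restricted to `T`, so independence
  -- of `T` is exactly its injectivity on columns from simple objects.
  have hcomp : incl ≫ familyMap θ X x =
      (tensorMap θ.inv (𝟙 W) : Z ⟶ tensor A W) ≫ (inducedDesc X (subfamilyHom x T)).hom := by
    refine hom_ext fun q => ?_
    rw [comp_col, monomial_col, post_single (Y := ZE) _ (q.1, q.2.1), pre_id]
    refine Eq.trans ?_ (post_inducedDesc X (subfamilyHom x T) (gen θ q.1)
      (single (Y := W) q.2 (𝟙 _))).symm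
    rw [post_single (Y := W), pre_id]
    rfl
  refine isIso_of_bijective_of_simple hC _ (fun N hN y hy => ?_) (fun N y => ?_)
  · let z : Col N Z := post (Y := tensor A W) (tensorMap θ.hom (𝟙 W)) y
    have hzy : post (Z := tensor A W) (tensorMap θ.inv (𝟙 W)) z = y := by
      refine (post_comp (Y := tensor A W) (Z := Z) _ _ _).symm.trans ?_
      have h : tensorMap θ.hom (𝟙 W) ≫ tensorMap θ.inv (𝟙 W) = 𝟙 (tensor A W) :=
        hom_inv_whiskerRight θ W
      rw [h]
      exact post_id _
    have hz : post (familyMap θ X x) (post incl z) = 0 := by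
      rw [← post_comp, hcomp]
      refine (post_comp (Z := tensor A W) _ _ _).trans ?_
      rw [hzy]
      exact hy
    have hz0 := hT.prop N hN (post incl z) (hincl' N z) hz
    have hz1 : z = 0 := DFinsupp.ext fun q => by
      rw [← hincl, hz0]
      rfl
    rw [← hzy, hz1]
    exact map_zero _
  · induction y using col_induction with
    | zero => exact ⟨0, map_zero _⟩
    | add a b ha hb =>
      obtain ⟨a', rfl⟩ := ha
      obtain ⟨b', rfl⟩ := hb
      exact ⟨a' + b', map_add _ _ _⟩
    | of t f =>
      -- Split the summand containing the image of `f` into its simple constituents and lift each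
      -- generator `x ⟨t, k⟩`.
      choose z hz using fun k => hgen ⟨t, k⟩
      refine ⟨∑ k, pre (f ≫ p t k) (z k), ?_⟩
      rw [map_sum]
      have h : ∀ k, post (inducedDesc X (subfamilyHom x T)).hom (pre (f ≫ p t k) (z k)) =
          single t (f ≫ p t k ≫ i t k) := by
        intro k
        rw [post_pre, hz]
        refine (pre_single _ _ _).trans ?_
        rw [Category.assoc]
      refine (Finset.sum_congr rfl fun k _ => h k).trans ?_
      rw [← map_sum, ← Preadditive.comp_sum, hps, Category.comp_id]

end DirectSumCompletion

/-! ### Isomorphisms and submodules of modules -/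

section Modules

variable {D : Type u} [Category.{v} D] [MonoidalCategory D] {A : D} [MonObj A]

lemma isIso_of_isIso_mod_hom {X Y : Mod D A} (f : X ⟶ Y) [IsIso f.hom] : IsIso f := by
  have : IsModHom A (asIso f.hom).hom := inferInstanceAs (IsModHom A f.hom)
  have : IsModHom A (inv f.hom) :=
    inferInstanceAs (IsModHom A (asIso f.hom).inv)
  exact ⟨Mod.Hom.mk (inv f.hom), Mod.hom_ext _ _ (IsIso.hom_inv_id f.hom),
    Mod.hom_ext _ _ (IsIso.inv_hom_id f.hom)⟩

/-- A submodule of a local module is local. -/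
lemma isLocalModule_of_mono [BraidedCategory D] {X Y : Mod D A} (f : Y ⟶ X) [Mono f.hom]
    (hX : isLocalModule A X) : isLocalModule A Y := by
  have hf : ModObj.smul (M := A) (X := Y.X) ≫ f.hom = A ◁ f.hom ≫ ModObj.smul (M := A) (X := X.X) :=
    IsModHom.smul_hom (A := A) (f := f.hom)
  have hX' : (β_ A X.X).hom ≫ (β_ X.X A).hom ≫ ModObj.smul (M := A) (X := X.X) =
    ModObj.smul (M := A) (X := X.X) := hX
  change (β_ A Y.X).hom ≫ (β_ Y.X A).hom ≫ ModObj.smul (M := A) (X := Y.X) =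
    ModObj.smul (M := A) (X := Y.X)
  refine (cancel_mono f.hom).1 ?_
  -- By naturality the monodromy passes through `f`, so locality may be checked in `X`.
  rw [Category.assoc, Category.assoc, hf, ← BraidedCategory.braiding_naturality_left_assoc,
    ← BraidedCategory.braiding_naturality_right_assoc, hX']

end Modules

/-! ### An induced module as the coproduct of its summands -/

namespace DirectSumCompletion

variable {C : Type u} [Category.{v} C] [Preadditive C]

/-- The inclusion of a summand into a formal direct sum. -/
def summandIncl (W : DirectSumCompletion.{w} C) (t : W.ι) : of (W.obj t) ⟶ W :=
  ofCol (single t (𝟙 (W.obj t)))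

lemma exists_retraction (W : DirectSumCompletion.{w} C) (t : W.ι) :
    ∃ r : W ⟶ of (W.obj t), summandIncl W t ≫ r = 𝟙 _ := by
  classical
  refine ⟨Hom.mk (Y := of (W.obj t)) fun s => if h : s = t then
    single (Y := of (W.obj t)) PUnit.unit (eqToHom (by rw [h])) else 0, hom_ext fun _ => ?_⟩
  rw [comp_col]
  refine (post_single _ t (𝟙 (W.obj t))).trans ?_
  rw [pre_id]
  exact dif_pos rfl

lemma summandIncl_hom_ext {W X : DirectSumCompletion.{w} C} {f g : W ⟶ X}
    (h : ∀ t, summandIncl W t ≫ f = summandIncl W t ≫ g) : f = g := by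
  refine hom_ext fun t => ?_
  have h' := congrArg (fun k => Hom.col k PUnit.unit) (h t)
  have key : ∀ f : W ⟶ X, Hom.col (summandIncl W t ≫ f) PUnit.unit = Hom.col f t := fun f =>
    (post_single f t (𝟙 (W.obj t))).trans (pre_id _)
  rwa [key, key] at h'

variable [MonoidalCategory C] [MonoidalPreadditive C] {A : DirectSumCompletion.{w} C} [MonObj A]

/-- The summands of an induced module. -/
def inducedIncl (A : DirectSumCompletion.{w} C) [MonObj A] (W : DirectSumCompletion.{w} C)
    (t : W.ι) : inducedModule A (of (W.obj t)) ⟶ inducedModule A W :=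
  inducedDesc _ (summandIncl W t ≫ inducedUnit A W)

lemma inducedIncl_hom (W : DirectSumCompletion.{w} C) (t : W.ι) :
    (inducedIncl A W t).hom = (A ◁ summandIncl W t : A ⊗ of (W.obj t) ⟶ A ⊗ W) := by
  have h := inducedDesc_inducedUnit (𝟙 (inducedModule A W))
  have h2 := congrArg Mod.Hom.hom h
  rw [Mod.id_hom', Category.comp_id, inducedDesc_hom] at h2
  rw [inducedIncl, inducedDesc_hom, MonoidalCategory.whiskerLeft_comp, Category.assoc, h2]
  exact Category.comp_id _

instance (W : DirectSumCompletion.{w} C) (t : W.ι) : Mono (inducedIncl A W t).hom := by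
  obtain ⟨r, hr⟩ := exists_retraction W t
  have h : (A ◁ summandIncl W t : A ⊗ of (W.obj t) ⟶ A ⊗ W) ≫ A ◁ r = 𝟙 _ := by
    rw [← MonoidalCategory.whiskerLeft_comp, hr, whiskerLeft_id]
  have : Mono (A ◁ summandIncl W t : A ⊗ of (W.obj t) ⟶ A ⊗ W) := mono_of_mono_fac h
  rw [inducedIncl_hom]
  exact this

lemma inducedUnit_inducedIncl (W : DirectSumCompletion.{w} C) (t : W.ι) :
    inducedUnit A _ ≫ (inducedIncl A W t).hom = summandIncl W t ≫ inducedUnit A W :=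
  inducedUnit_inducedDesc _ _

lemma inducedIncl_hom_ext {W : DirectSumCompletion.{w} C} {X : Mod (DirectSumCompletion.{w} C) A}
    {f g : inducedModule A W ⟶ X} (h : ∀ t, inducedIncl A W t ≫ f = inducedIncl A W t ≫ g) :
    f = g := by
  refine induced_hom_ext (summandIncl_hom_ext fun t => ?_)
  rw [← Category.assoc, ← Category.assoc, ← inducedUnit_inducedIncl, Category.assoc, Category.assoc]
  exact congrArg (fun k => inducedUnit A _ ≫ k) (congrArg Mod.Hom.hom (h t))

/-- A map out of `A ⊗ W` is a map out of `W`, which may be prescribed freely on each summand. With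
`inducedIncl_hom_ext` this is the universal property of the coproduct. -/
lemma exists_inducedIncl_comp_eq {W : DirectSumCompletion.{w} C}
    {X : Mod (DirectSumCompletion.{w} C) A} (f : ∀ t, inducedModule A (of (W.obj t)) ⟶ X) :
    ∃ g : inducedModule A W ⟶ X, ∀ t, inducedIncl A W t ≫ g = f t := by
  refine ⟨inducedDesc X (Hom.mk fun t => Hom.col (inducedUnit A _ ≫ (f t).hom) PUnit.unit),
    fun t => induced_hom_ext ?_⟩
  rw [Mod.comp_hom', ← Category.assoc, inducedUnit_inducedIncl, Category.assoc,
    inducedUnit_inducedDesc]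
  refine hom_ext fun _ => ?_
  exact (post_single _ t (𝟙 (W.obj t))).trans (pre_id _)

end DirectSumCompletion

/-! ### Simple local modules and complete reducibility -/

namespace IsSimpleCurrentExtension

open DirectSumCompletion

variable {C : Type u} [Category.{v} C] [Abelian C] [MonoidalCategory C] [MonoidalPreadditive C]
  [BraidedCategory C] {A : DirectSumCompletion.{w} C} [MonObj A] {P : ParityDecomposition A}
  {I : Type w} {J : I → C}

lemma simple_tensor (hA : IsSimpleCurrentExtension A P J) (i : I) (M : C) (hM : Simple M) :
    Simple (J i ⊗ M) :=
  (hA.simpleCurrent i).simple_tensor M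

lemma isEmpty_iso_tensor (hA : IsSimpleCurrentExtension A P J) (hJ : IsFixedPointFree J) (i j : I)
    (M : C) (hM : Simple M) (hij : i ≠ j) : IsEmpty (J i ⊗ M ≅ J j ⊗ M) :=
  ⟨fun e => hJ M hM ⟨i, j, hA.inequivalent i j hij, ⟨e⟩⟩⟩

lemma exists_inverse (hC : IsSemisimpleAbelian C) (hA : IsSimpleCurrentExtension A P J)
    (θ : A ≅ ⟨I, J⟩) (i : I) : ∃ (l : I) (ψ : 𝟙_ C ⟶ J l ⊗ J i),
      pre ψ (mulCol (gen θ l) (gen θ i)) = oneCol A :=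
  have := hA.simple
  have := simple_unit hC θ hA.simpleCurrent
  exists_mulCol_eq_oneCol θ hA.simpleCurrent hA.inequivalent i

/-- Every module over a fixed-point free simple current extension is induced from a sum of simple
objects. -/
lemma exists_isIso_inducedDesc (hC : IsSemisimpleAbelian C) (hA : IsSimpleCurrentExtension A P J)
    (hJ : IsFixedPointFree J) (X : Mod (DirectSumCompletion.{w} C) A) :
    ∃ (W : DirectSumCompletion.{w} C) (w : W ⟶ X.X), (∀ t, Simple (W.obj t)) ∧
      IsIso (inducedDesc X w) := by
  obtain ⟨θ⟩ := hA.decomposition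
  obtain ⟨W, w, hW, h⟩ := DirectSumCompletion.exists_isIso_inducedDesc hC θ (hA.exists_inverse hC θ)
    hA.simple_tensor (hA.isEmpty_iso_tensor hJ) X
  exact ⟨W, w, hW, isIso_of_isIso_mod_hom _⟩

/-- `A ◁ -` is faithful on morphisms of `C`, so it cannot annihilate the identity of a simple
object. -/
lemma id_induced_ne_zero (hA : IsSimpleCurrentExtension A P J) (M : C) [Simple M] :
    𝟙 (inducedModule A (of M)) ≠ 0 := by
  intro h
  have := hA.simple
  obtain ⟨θ⟩ := hA.decomposition
  obtain ⟨i⟩ := nonempty_of_simple θ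
  have h0 : 𝟙 (A ⊗ of M) = 0 := congrArg Mod.Hom.hom h
  refine id_nonzero M (whiskerLeft_ofMap_injective θ i (hA.simpleCurrent i) ?_)
  rw [ofMap_id, ofMap_zero, whiskerLeft_id, h0, MonoidalPreadditive.whiskerLeft_zero]

/-- A local module induced from a simple object is simple. -/
lemma simple_induced (hC : IsSemisimpleAbelian C) (hA : IsSimpleCurrentExtension A P J)
    (hJ : IsFixedPointFree J) (M : C) [Simple M]
    (hloc : isLocalModule A (inducedModule A (of M))) :
    Simple (⟨inducedModule A (of M), hloc⟩ : LocalModule A) where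
  mono_isIso_iff_nonzero {Y} f _ := by
    constructor
    · rintro hf rfl
      have h : 𝟙 (⟨inducedModule A (of M), hloc⟩ : LocalModule A) = 0 := by
        rw [← IsIso.inv_hom_id (0 : Y ⟶ ⟨inducedModule A (of M), hloc⟩), comp_zero]
      exact hA.id_induced_ne_zero M (congrArg (fun g => g.hom) h)
    · intro hf
      obtain ⟨θ⟩ := hA.decomposition
      obtain ⟨W, w, hW, hw⟩ := hA.exists_isIso_inducedDesc hC hJ Y.obj
      -- The subobject `Y` is itself induced, so the nonzero `f` is nonzero on some `A ⊗ W.obj t`.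
      -- That restriction splits, hence so does `f`, and a split epimorphism that is mono is an
      -- isomorphism.
      obtain ⟨t, ht⟩ : ∃ t, inducedIncl A W t ≫ inducedDesc Y.obj w ≫ f.hom ≠ 0 := by
        by_contra! h
        have h0 : inducedDesc Y.obj w ≫ f.hom = 0 := inducedIncl_hom_ext fun t => by
          rw [h t, comp_zero]
        have h1 : f.hom = 0 := by rw [← cancel_epi (inducedDesc Y.obj w), h0, comp_zero]
        exact hf ((isLocalModule A).hom_ext h1)
      have := hW t
      have := isSplitEpi_of_ne_zero θ hA.simple_tensor (hA.isEmpty_iso_tensor hJ)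
        (hA.exists_inverse hC θ) _ ht
      have : IsSplitEpi f := ⟨⟨⟨ObjectProperty.homMk
        (section_ (inducedIncl A W t ≫ inducedDesc Y.obj w ≫ f.hom) ≫ inducedIncl A W t ≫
          inducedDesc Y.obj w), (isLocalModule A).hom_ext (by
            have h := IsSplitEpi.id (inducedIncl A W t ≫ inducedDesc Y.obj w ≫ f.hom)
            refine Eq.trans ?_ h
            change (_ ≫ _ ≫ _) ≫ f.hom = _
            simp only [Category.assoc])⟩⟩⟩
      exact isIso_of_mono_of_isSplitEpi f

/-- Every local module over a fixed-point free simple current extension is a direct sum of simple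
local modules. -/
lemma isCompletelyReducible (hC : IsSemisimpleAbelian C) (hA : IsSimpleCurrentExtension A P J)
    (hJ : IsFixedPointFree J) (X : LocalModule A) : IsCompletelyReducible.{w} X := by
  obtain ⟨W, w, hW, hw⟩ := hA.exists_isIso_inducedDesc hC hJ X.obj
  -- Each `A ⊗ W.obj t` embeds in `X`, so locality descends to it and the decomposition takes place
  -- among local modules.
  have hloc : ∀ t, isLocalModule A (inducedModule A (of (W.obj t))) := fun t => by
    have hm : IsIso (inducedDesc X.obj w).hom :=
      inferInstanceAs (IsIso ((Mod.forget A).map (inducedDesc X.obj w)))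
    have : Mono (inducedIncl A W t ≫ inducedDesc X.obj w).hom :=
      inferInstanceAs (Mono ((inducedIncl A W t).hom ≫ (inducedDesc X.obj w).hom))
    exact isLocalModule_of_mono (inducedIncl A W t ≫ inducedDesc X.obj w) X.property
  refine ⟨W.ι, fun t => ⟨inducedModule A (of (W.obj t)), hloc t⟩,
    fun t => ObjectProperty.homMk (inducedIncl A W t ≫ inducedDesc X.obj w),
    fun t => have := hW t; hA.simple_induced hC hJ (W.obj t) (hloc t), ⟨?_⟩⟩
  choose d hd using fun s : Cofan fun t => (⟨inducedModule A (of (W.obj t)), hloc t⟩ : LocalModule A)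
    => exists_inducedIncl_comp_eq (W := W) fun t => (s.inj t).hom
  refine Cofan.IsColimit.mk _ (fun s => ObjectProperty.homMk (inv (inducedDesc X.obj w) ≫ d s))
    (fun s t => (isLocalModule A).hom_ext ?_) (fun s m hm => (isLocalModule A).hom_ext ?_)
  · change (inducedIncl A W t ≫ inducedDesc X.obj w) ≫ inv (inducedDesc X.obj w) ≫ d s = _
    rw [Category.assoc, IsIso.hom_inv_id_assoc, hd]
  · change m.hom = inv (inducedDesc X.obj w) ≫ d s
    rw [IsIso.eq_inv_comp]
    refine inducedIncl_hom_ext fun t => ?_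
    rw [hd, ← hm t]
    exact (Category.assoc _ _ _).symm

end IsSimpleCurrentExtension

end

theorem mainTheorem11 {C : Type u} [Category.{v} C] [Abelian C] [MonoidalCategory C]
    [MonoidalPreadditive C] [BraidedCategory C] (hC : IsSemisimpleAbelian C)
    (A : DirectSumCompletion.{w} C) [MonObj A] (P : ParityDecomposition A)
    {I : Type w} (J : I → C) (hA : IsSimpleCurrentExtension A P J) (hJ : IsFixedPointFree J) :
    (∀ X : LocalModule A, IsCompletelyReducible.{w} X) ∧
      ∀ X : LocalModule A, ∃ W : DirectSumCompletion.{w} C,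
        Nonempty (X.obj ≅ inducedModule A W) := by
  refine ⟨hA.isCompletelyReducible hC hJ, fun X => ?_⟩
  obtain ⟨W, w, -, hw⟩ := hA.exists_isIso_inducedDesc hC hJ X.obj
  exact ⟨W, ⟨(asIso (inducedDesc X.obj w)).symm⟩⟩
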